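/- All graphs are finite, simple and undirected. For a graph $G$ let $I(G,x)=\sum_{k\ge 0} i_k x^k$ be its independence polynomial, where $i_k$ is the number of independent sets of size $k$ in $G$, and let $\xi(G)$ be the root of $I(G,x)$ of smallest modulus (for a graph with at least one vertex this root is real and negative). Write $H\preceq G$ if $I(H,x)\ge I(G,x)$ for all $x\in[\xi(G),0]$. A graph is unicyclic if it contains exactly one cycle, and well-covered if all of its maximal independent sets have the same size. For a graph $H$, let $H^{\ast}$ denote the corona of $H$ with $K_1$, that is, the graph obtained from $H$ by attaching to each vertex $v$ a new vertex $v^{\ast}$ by an edge. Let $C_n$ be the cycle on $n$ vertices, and let $U_n$ be the graph on $n$ vertices obtained from a triangle by attaching $n-3$ new vertices, by an edge each, to one fixed vertex of the triangle. **Theorem.** If $n\ge 3$ and $G$ is a connected well-covered unicyclic graph of order $2n$, then $$C_n^{\ast}\preceq G\preceq U_n^{\ast},$$ and hence $$\xi(C_n^{\ast})\le \xi(G)\le \xi(U_n^{\ast}).$$ -/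

import Mathlib

open Polynomial

namespace SimpleGraph

/-- `G` has exactly one cycle, a cycle being regarded as a subgraph of `G`. -/
def IsUnicyclic {V : Type*} (G : SimpleGraph V) : Prop :=
  ∃! C : G.Subgraph, ∃ (v : V) (p : G.Walk v v), p.IsCycle ∧ p.toSubgraph = C

/-- All maximal independent sets of `G` have the same size. -/
def IsWellCovered {V : Type*} (G : SimpleGraph V) : Prop :=
  ∀ s t : Finset V, Maximal G.IsIndepSet (s : Set V) → Maximal G.IsIndepSet (t : Set V) →
    s.card = t.card

/-- The graph star `G*`, that is, the corona of `G` with `K₁`: every vertex `v` of `G` (here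
`Sum.inl v`) gets a new pendant neighbour `v*` (here `Sum.inr v`). -/
def graphStar {V : Type*} (G : SimpleGraph V) : SimpleGraph (V ⊕ V) where
  Adj
    | .inl u, .inl v => G.Adj u v
    | .inl u, .inr v => u = v
    | .inr u, .inl v => u = v
    | .inr _, .inr _ => False
  symm := ⟨by
    rintro (u | u) (v | v) h
    · exact G.adj_symm h
    · exact Eq.symm h
    · exact Eq.symm h
    · exact h⟩
  loopless := ⟨by
    rintro (u | u) h
    · exact G.loopless.irrefl u h
    · exact h⟩

/-- The graph `U_n`: the triangle `0, 1, 2` together with `n - 3` further vertices `3, …, n - 1`,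
each of them joined to the vertex `0` only. -/
def triangleStar (n : ℕ) : SimpleGraph (Fin n) :=
  fromRel fun i j => i.val = 0 ∨ (i.val = 1 ∧ j.val = 2)

open Classical in
/-- The independence polynomial `I(G, x) = ∑ₖ iₖ xᵏ`, where `iₖ` is the number of independent sets
of size `k`: every independent set `s` contributes `x ^ |s|`. -/
noncomputable def indepPoly {V : Type*} [Fintype V] (G : SimpleGraph V) : ℝ[X] :=
  ∑ s ∈ Finset.univ.filter (fun s : Finset V => G.IsIndepSet (s : Set V)), X ^ s.card

/-- `r` is a root of the independence polynomial of `G`, and no complex root of the independence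
polynomial has smaller modulus. -/
def IsSmallestRoot {V : Type*} [Fintype V] (G : SimpleGraph V) (r : ℝ) : Prop :=
  G.indepPoly.IsRoot r ∧ ∀ z : ℂ, aeval z G.indepPoly = 0 → |r| ≤ ‖z‖

open Classical in
/-- `ξ(G)`, the independence root of smallest modulus. It is real, see `isSmallestRoot_xi` below;
the value `0` is taken only for the graph without vertices, which has no independence roots. -/
noncomputable def xi {V : Type*} [Fintype V] (G : SimpleGraph V) : ℝ :=
  if h : ∃ r : ℝ, G.IsSmallestRoot r then h.choose else 0

/-- The relation `H ⪯ G`: `I(H, x) ≥ I(G, x)` for all `x ∈ [ξ(G), 0]`. -/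
def IndepLE {W V : Type*} [Fintype W] [Fintype V] (H : SimpleGraph W) (G : SimpleGraph V) : Prop :=
  ∀ x ∈ Set.Icc G.xi 0, G.indepPoly.eval x ≤ H.indepPoly.eval x

section WellDefined

variable {V : Type*} (G : SimpleGraph V)

open Classical in
/-- The independence polynomial of the subgraph induced by `S`, evaluated at `x`. -/
noncomputable def indepSum {R : Type*} [CommRing R] (x : R) (S : Finset V) : R :=
  ∑ s ∈ S.powerset.filter (fun s : Finset V => G.IsIndepSet (s : Set V)), x ^ s.card

open Classical in
theorem indepSum_insert {R : Type*} [CommRing R] (x : R) {S : Finset V} {v : V} (hv : v ∉ S) :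
    G.indepSum x (insert v S) =
      G.indepSum x S + x * G.indepSum x (S.filter fun u => ¬ G.Adj v u) := by
  unfold indepSum
  rw [Finset.powerset_insert, Finset.filter_union, Finset.sum_union]
  · congr 1
    rw [Finset.mul_sum]
    symm
    apply Finset.sum_bij (fun s _ => insert v s)
    · intro s hs
      simp only [Finset.mem_filter, Finset.mem_powerset, Finset.mem_image] at hs ⊢
      refine ⟨⟨s, fun a ha => (Finset.mem_filter.1 (hs.1 ha)).1, rfl⟩, ?_⟩
      rw [Finset.coe_insert, isIndepSet_iff]
      refine Set.Pairwise.insert hs.2 fun b hb _ => ?_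
      have := (Finset.mem_filter.1 (hs.1 hb)).2
      exact ⟨this, fun h => this h.symm⟩
    · intro s hs t ht h
      simp only [Finset.mem_filter, Finset.mem_powerset] at hs ht
      have hs' : v ∉ s := fun h => hv (Finset.mem_filter.1 (hs.1 h)).1
      have ht' : v ∉ t := fun h => hv (Finset.mem_filter.1 (ht.1 h)).1
      rw [← Finset.erase_insert hs', ← Finset.erase_insert ht', h]
    · intro t ht
      simp only [Finset.mem_filter, Finset.mem_powerset, Finset.mem_image] at ht
      obtain ⟨⟨s, hs, rfl⟩, ht⟩ := ht
      refine ⟨s, ?_, rfl⟩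
      simp only [Finset.mem_filter, Finset.mem_powerset]
      refine ⟨fun a ha => Finset.mem_filter.2 ⟨hs ha, ?_⟩, ?_⟩
      · refine ht (by simp) (by simp [ha]) ?_
        rintro rfl
        exact hv (hs ha)
      · exact ht.mono (by simp)
    · intro s hs
      simp only [Finset.mem_filter, Finset.mem_powerset] at hs
      have hs' : v ∉ s := fun h => hv (Finset.mem_filter.1 (hs.1 h)).1
      rw [Finset.card_insert_of_notMem hs', pow_succ']
  · rw [Finset.disjoint_left]
    intro s hs hs'
    simp only [Finset.mem_filter, Finset.mem_powerset, Finset.mem_image] at hs hs'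
    obtain ⟨⟨t, _, rfl⟩, _⟩ := hs'
    exact hv (hs.1 (by simp))

theorem indepSum_empty {R : Type*} [CommRing R] (x : R) : G.indepSum x ∅ = 1 := by
  unfold indepSum
  simp [Finset.filter_singleton, isIndepSet_iff]

theorem indepSum_zero {R : Type*} [CommRing R] (S : Finset V) : G.indepSum (0 : R) S = 1 := by
  classical
  induction S using Finset.induction_on with
  | empty => exact G.indepSum_empty 0
  | insert v S hv ih => rw [indepSum_insert G _ hv, ih]; simp

theorem indepSum_singleton {R : Type*} [CommRing R] (x : R) (v : V) :
    G.indepSum x {v} = 1 + x := by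
  classical
  have := indepSum_insert G x (Finset.notMem_empty v)
  simpa [indepSum_empty] using this

theorem continuous_indepSum (S : Finset V) : Continuous fun t : ℝ => G.indepSum (-t) S := by
  unfold indepSum
  fun_prop

/-- The values at `-t` decrease when the set of vertices grows. -/
theorem indepSum_anti {t : ℝ} (ht : 0 ≤ t) (h : ∀ S, 0 ≤ G.indepSum (-t) S) {A S : Finset V}
    (hA : A ⊆ S) : G.indepSum (-t) S ≤ G.indepSum (-t) A := by
  classical
  have key : ∀ B : Finset V, G.indepSum (-t) (A ∪ B) ≤ G.indepSum (-t) A := by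
    intro B
    induction B using Finset.induction_on with
    | empty => simp
    | insert v B _ ih =>
      rw [Finset.union_insert]
      by_cases hv : v ∈ A ∪ B
      · rwa [Finset.insert_eq_of_mem hv]
      · rw [indepSum_insert G _ hv]
        nlinarith [mul_nonneg ht (h ((A ∪ B).filter fun u => ¬ G.Adj v u))]
  simpa [Finset.union_eq_right.2 hA] using key S

/-- On the circle `‖z‖ = t` the moduli of the quotients of these values are smallest at `-t`. -/
theorem indepSum_norm {t : ℝ} (ht : 0 ≤ t) (h : ∀ S, 0 < G.indepSum (-t) S) {z : ℂ}
    (hz : ‖z‖ = t) : ∀ (n : ℕ) (S : Finset V), S.card = n → ∀ A ⊆ S,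
      G.indepSum (-t) S * ‖G.indepSum z A‖ ≤ ‖G.indepSum z S‖ * G.indepSum (-t) A := by
  classical
  intro n
  induction n with
  | zero =>
    intro S hS A hA
    obtain rfl := Finset.card_eq_zero.1 hS
    obtain rfl := Finset.subset_empty.1 hA
    rw [mul_comm]
  | succ n ih =>
    intro S hS A hA
    by_cases hAS : A = S
    · rw [hAS, mul_comm]
    obtain ⟨v, hvS, hvA⟩ := Finset.exists_of_ssubset (hA.ssubset_of_ne hAS)
    obtain ⟨T, hvT, rfl⟩ : ∃ T, v ∉ T ∧ S = insert v T :=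
      ⟨S.erase v, by simp, by rw [Finset.insert_erase hvS]⟩
    have hT : T.card = n := by rw [Finset.card_insert_of_notMem hvT] at hS; omega
    have h1 := ih T hT A ((Finset.subset_insert_iff_of_notMem hvA).1 hA)
    have h2 := ih T hT (T.filter fun u => ¬ G.Adj v u) (Finset.filter_subset _ _)
    have e1 := indepSum_insert G (-t) hvT
    have e2 := indepSum_insert G z hvT
    set B := T.filter fun u => ¬ G.Adj v u
    have h3 : ‖G.indepSum z T‖ - t * ‖G.indepSum z B‖ ≤ ‖G.indepSum z (insert v T)‖ := by
      rw [e2, ← hz, ← norm_mul]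
      have := norm_sub_le (G.indepSum z T + z * G.indepSum z B) (z * G.indepSum z B)
      rw [add_sub_cancel_right] at this
      linarith
    have pT := h T
    have pA := h A
    -- one step, from `T` to `insert v T`
    have h4 : G.indepSum (-t) (insert v T) * ‖G.indepSum z T‖
        ≤ ‖G.indepSum z (insert v T)‖ * G.indepSum (-t) T := by
      rw [e1]
      nlinarith [mul_le_mul_of_nonneg_left h2 ht, mul_le_mul_of_nonneg_right h3 pT.le]
    have h5 := mul_le_mul_of_nonneg_left h1 (h (insert v T)).le
    have h6 := mul_le_mul_of_nonneg_right h4 pA.le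
    refine le_of_mul_le_mul_left ?_ pT
    nlinarith

theorem indepSum_univ [Fintype V] {R : Type*} [CommRing R] [Algebra ℝ R] (x : R) :
    aeval x G.indepPoly = G.indepSum x Finset.univ := by
  simp [indepPoly, indepSum]

/-- A graph with at least one vertex has a real independence root of smallest modulus. -/
theorem exists_isSmallestRoot [Fintype V] [Nonempty V] : ∃ r : ℝ, G.IsSmallestRoot r := by
  classical
  set Z : Set ℝ := ⋃ S : Finset V, {t : ℝ | 0 ≤ t ∧ G.indepSum (-t) S = 0} with hZ
  have hclosed : IsClosed Z := by
    refine isClosed_iUnion_of_finite fun S => ?_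
    exact isClosed_Ici.inter (isClosed_eq (G.continuous_indepSum S) continuous_const)
  have hne : Z.Nonempty := by
    obtain ⟨v⟩ := ‹Nonempty V›
    refine ⟨1, Set.mem_iUnion.2 ⟨{v}, zero_le_one, ?_⟩⟩
    rw [indepSum_singleton]; ring
  have hbdd : BddBelow Z := ⟨0, by
    rintro t ht
    obtain ⟨S, hS⟩ := Set.mem_iUnion.1 ht
    exact hS.1⟩
  obtain ⟨S₀, hρ0, hρ⟩ := Set.mem_iUnion.1 (hclosed.csInf_mem hne hbdd)
  set ρ := sInf Z
  have hpos : ∀ t, 0 ≤ t → t < ρ → ∀ S, 0 < G.indepSum (-t) S := by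
    intro t ht htρ S
    by_contra hS
    obtain ⟨c, hc, hc0⟩ := intermediate_value_Icc' ht (G.continuous_indepSum S).continuousOn
      (show (0 : ℝ) ∈ _ from ⟨not_lt.1 hS, by simp [indepSum_zero]⟩)
    exact absurd (csInf_le hbdd (Set.mem_iUnion.2 ⟨S, hc.1, hc0⟩)) (not_le.2 (hc.2.trans_lt htρ))
  have hρpos : 0 < ρ := by
    refine lt_of_le_of_ne hρ0 fun h0 => ?_
    rw [← h0, neg_zero, indepSum_zero] at hρ
    exact one_ne_zero hρ
  have hnonneg : ∀ S, 0 ≤ G.indepSum (-ρ) S := by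
    intro S
    have hcl : ρ ∈ closure (Set.Ico 0 ρ) := by
      rw [closure_Ico hρpos.ne]; exact ⟨hρ0, le_rfl⟩
    have := (isClosed_Ici (a := (0 : ℝ))).preimage (G.continuous_indepSum S)
    exact closure_minimal (fun t ht => (hpos t ht.1 ht.2 S).le) this hcl
  refine ⟨-ρ, ?_, ?_⟩
  · have h1 := G.indepSum_anti hρ0 hnonneg (Finset.subset_univ S₀)
    rw [hρ] at h1
    have := G.indepSum_univ (-ρ)
    rw [coe_aeval_eq_eval] at this
    rw [IsRoot, this]
    exact le_antisymm h1 (hnonneg _)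
  · intro z hz
    rw [abs_neg, abs_of_nonneg hρ0]
    by_contra hlt
    have hp := hpos ‖z‖ (norm_nonneg z) (not_le.1 hlt)
    have := G.indepSum_norm (norm_nonneg z) hp rfl _ Finset.univ rfl ∅ (Finset.empty_subset _)
    rw [← indepSum_univ G z, hz, indepSum_empty] at this
    simp only [norm_one, mul_one, norm_zero, zero_mul] at this
    exact absurd (hp Finset.univ) (not_lt.2 this)

theorem isSmallestRoot_xi [Fintype V] [Nonempty V] : G.IsSmallestRoot G.xi := by
  have h := G.exists_isSmallestRoot
  rw [xi, dif_pos h]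
  exact h.choose_spec

end WellDefined

end SimpleGraph

open Polynomial

namespace SimpleGraph

open scoped Classical

/-! ### Recurrences for independence polynomials of induced subgraphs. -/

section IndepSum

variable {V W : Type*} (G : SimpleGraph V) {R : Type*} [CommRing R]

/-! The comparison is reduced to connected unicyclic graphs `H` on `n` vertices and made there at
one negative argument. Well-coveredness gives `G` a perfect matching and makes every maximal
independent set meet every matching edge. Contracting the matching produces a connected graph `H`
with `n` vertices and `n` edges, hence a tree plus an edge. Usually `G` is the corona of `H`. The
only other possibility is that one matching edge has two ends of degree 2 on a 4-cycle; contraction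
turns that cycle into a triangle, and inclusion-exclusion on the opposite edge shows that `G` still
has the independence polynomial of the corona (`IsTightMatching.indepPoly_eq`).

For coronas, `I(H*, x) = (1 + x)^n I(H, x/(1 + x))` (`eval_graphStar`). So it suffices to compare
`H` with the cycle and with the triangle star at `-s = x/(1 + x)`, where `ξ(H*) < x ≤ 0`. On this
range all induced subgraphs of `H` have positive value (`indepSum_pos_of_graphStar`), so ratios of
values may be compared.

Removing one cycle edge at `u` and splitting the resulting tree at the other cycle edge at `u`
presents `H` as two trees `A` and `B`, with `u` in `A` joined to exactly two vertices of `B`. Upper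
bounds on each tree come from the path (`TreeOn.bounds`, `TreeOn.pair_bound`), lower bounds from the
star (`TreeOn.star_le`). Combined, they give the cycle as the maximum and the triangle star as the
minimum (`unicyclic_le`, `le_unicyclic`). The order of the roots follows from the inequalities by
the intermediate value theorem. -/

theorem indepSum_congr {G G' : SimpleGraph V} (x : R) {S : Finset V}
    (h : ∀ a ∈ S, ∀ b ∈ S, G.Adj a b ↔ G'.Adj a b) : G.indepSum x S = G'.indepSum x S := by
  unfold indepSum
  congr 1
  refine Finset.filter_congr fun s hs => ?_
  rw [Finset.mem_powerset] at hs
  rw [isIndepSet_iff, isIndepSet_iff]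
  constructor <;> intro H a ha b hb hab
  · rw [← h a (hs ha) b (hs hb)]; exact H ha hb hab
  · rw [h a (hs ha) b (hs hb)]; exact H ha hb hab

theorem indepSum_insert_of_isolated (x : R) {S : Finset V} {v : V} (hv : v ∉ S)
    (h : ∀ u ∈ S, ¬ G.Adj v u) : G.indepSum x (insert v S) = (1 + x) * G.indepSum x S := by
  rw [indepSum_insert G x hv, Finset.filter_true_of_mem h]
  ring

theorem indepSum_eq_pow (x : R) (S : Finset V) (h : ∀ u ∈ S, ∀ v ∈ S, ¬ G.Adj u v) :
    G.indepSum x S = (1 + x) ^ S.card := by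
  induction S using Finset.induction_on with
  | empty => simp [indepSum_empty]
  | insert v S hv ih =>
    rw [indepSum_insert_of_isolated G x hv fun u hu => h v (by simp) u (by simp [hu]),
      ih fun a ha b hb => h a (by simp [ha]) b (by simp [hb]), Finset.card_insert_of_notMem hv,
      pow_succ']

theorem indepSum_eq_erase (x : R) {S : Finset V} {v : V} (hv : v ∈ S) :
    G.indepSum x S = G.indepSum x (S.erase v) +
      x * G.indepSum x ((S.erase v).filter fun u => ¬ G.Adj v u) := by
  conv_lhs => rw [← Finset.insert_erase hv]
  exact indepSum_insert G x (Finset.notMem_erase v S)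

theorem indepSum_union (x : R) {A B : Finset V} (hd : Disjoint A B)
    (h : ∀ a ∈ A, ∀ b ∈ B, ¬ G.Adj a b) :
    G.indepSum x (A ∪ B) = G.indepSum x A * G.indepSum x B := by
  induction hn : A.card using Nat.strong_induction_on generalizing A with
  | _ n ih =>
    subst hn
    rcases A.eq_empty_or_nonempty with rfl | ⟨v, hv⟩
    · simp [indepSum_empty]
    have hvB : v ∉ B := Finset.disjoint_left.1 hd hv
    rw [indepSum_eq_erase G x hv, indepSum_eq_erase G x (Finset.mem_union_left B hv),
      Finset.erase_union_distrib, Finset.erase_eq_of_notMem hvB, Finset.filter_union,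
      Finset.filter_true_of_mem (s := B) (h v hv)]
    have hlt := Finset.card_erase_lt_of_mem hv
    have hsub := Finset.filter_subset (fun u => ¬ G.Adj v u) (A.erase v)
    rw [ih _ hlt (hd.mono_left (Finset.erase_subset v A))
        (fun a ha => h a (Finset.mem_of_mem_erase ha)) rfl,
      ih _ ((Finset.card_le_card hsub).trans_lt hlt)
        (hd.mono_left (hsub.trans (Finset.erase_subset v A)))
        (fun a ha => h a (Finset.mem_of_mem_erase (hsub ha))) rfl]
    ring

/-- The independence polynomial of two vertex sets between which all edges start in `u`. -/
theorem indepSum_join (x : R) {A B : Finset V} {u : V} (hd : Disjoint A B) (hu : u ∈ A)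
    (h : ∀ a ∈ A, ∀ b ∈ B, G.Adj a b → a = u) :
    G.indepSum x (A ∪ B) = G.indepSum x (A.erase u) * G.indepSum x B +
      (G.indepSum x A - G.indepSum x (A.erase u)) *
        G.indepSum x (B.filter fun b => ¬ G.Adj u b) := by
  have huB : u ∉ B := Finset.disjoint_left.1 hd hu
  have hd' := hd.mono_left (Finset.erase_subset u A)
  have hne : ∀ a ∈ A.erase u, ∀ b ∈ B, ¬ G.Adj a b := fun a ha b hb hab =>
    Finset.ne_of_mem_erase ha (h a (Finset.mem_of_mem_erase ha) b hb hab)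
  rw [indepSum_eq_erase G x hu, indepSum_eq_erase G x (Finset.mem_union_left B hu),
    Finset.erase_union_distrib, Finset.erase_eq_of_notMem huB, Finset.filter_union,
    indepSum_union G x hd' hne,
    indepSum_union G x (hd'.mono (Finset.filter_subset _ _) (Finset.filter_subset _ _))
      (fun a ha b hb => hne a (Finset.filter_subset _ _ ha) b (Finset.filter_subset _ _ hb))]
  ring

theorem indepSum_map (f : W ↪ V) (x : R) (S : Finset W) :
    G.indepSum x (S.map f) = (G.comap f).indepSum x S := by
  induction hn : S.card using Nat.strong_induction_on generalizing S with
  | _ n ih =>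
    subst hn
    rcases S.eq_empty_or_nonempty with rfl | ⟨v, hv⟩
    · simp [indepSum_empty]
    have hlt := Finset.card_erase_lt_of_mem hv
    rw [indepSum_eq_erase _ x hv, indepSum_eq_erase _ x (Finset.mem_map_of_mem f hv),
      ← Finset.map_erase, Finset.filter_map, ih _ hlt _ rfl,
      ih _ ((Finset.card_le_card (Finset.filter_subset _ _)).trans_lt hlt) _ rfl]
    simp only [Function.comp_def, comap_adj]

theorem eval_indepPoly [Fintype V] (x : ℝ) :
    G.indepPoly.eval x = G.indepSum x Finset.univ := by
  rw [← G.indepSum_univ x, coe_aeval_eq_eval]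

theorem eval_indepPoly_comap [Fintype V] [Fintype W] (f : W ≃ V) (x : ℝ) :
    (G.comap f).indepPoly.eval x = G.indepPoly.eval x := by
  rw [eval_indepPoly, eval_indepPoly, ← Finset.map_univ_equiv f, indepSum_map]
  rfl

end IndepSum

/-! ### Positivity of all induced subgraphs to the right of `ξ`. -/

section Positivity

variable {V : Type*} (G : SimpleGraph V) {s : ℝ}

theorem indepSum_le_one (hs : 0 ≤ s) (h : ∀ S, 0 ≤ G.indepSum (-s) S) (S : Finset V) :
    G.indepSum (-s) S ≤ 1 := by
  simpa [indepSum_empty] using G.indepSum_anti hs h (Finset.empty_subset S)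

/-- Adding a vertex subtracts `s` times the value of a subset, which is at least the current value;
so each new vertex costs a factor of at most `1 - s`. -/
theorem indepSum_union_le (hs : 0 ≤ s) (hs1 : s ≤ 1) (h : ∀ S, 0 ≤ G.indepSum (-s) S)
    (A B : Finset V) :
    G.indepSum (-s) (A ∪ B) ≤ (1 - s) ^ (B \ A).card * G.indepSum (-s) A := by
  rw [← Finset.union_sdiff_self_eq_union]
  have hd : Disjoint A (B \ A) := Finset.disjoint_sdiff
  generalize B \ A = C at hd ⊢
  induction C using Finset.induction_on with
  | empty => simp
  | insert v C hv ih =>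
    rw [Finset.disjoint_insert_right] at hd
    have hv' : v ∉ A ∪ C := by simp [hv, hd.1]
    rw [Finset.union_insert, indepSum_insert G _ hv', Finset.card_insert_of_notMem hv, pow_succ',
      mul_assoc]
    have h1 := G.indepSum_anti hs h (Finset.filter_subset (fun u => ¬ G.Adj v u) (A ∪ C))
    have h2 := mul_le_mul_of_nonneg_left h1 hs
    have h3 := mul_le_mul_of_nonneg_left (ih hd.2) (sub_nonneg.2 hs1)
    linarith

theorem indepSum_le_pow (hs : 0 ≤ s) (hs1 : s ≤ 1) (h : ∀ S, 0 ≤ G.indepSum (-s) S)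
    (S : Finset V) : G.indepSum (-s) S ≤ (1 - s) ^ S.card := by
  simpa [indepSum_empty] using G.indepSum_union_le hs hs1 h ∅ S

theorem indepSum_pos_of_nonneg [Fintype V] {x : ℝ} (hx : 0 ≤ x) (S : Finset V) :
    0 < G.indepSum x S := by
  unfold indepSum
  refine Finset.sum_pos' (fun s _ => pow_nonneg hx _) ⟨∅, ?_, by simp⟩
  simp [isIndepSet_iff]

variable [Fintype V] [Nonempty V]

theorem xi_neg : G.xi < 0 := by
  by_contra h
  have h1 := G.isSmallestRoot_xi.1
  rw [IsRoot, eval_indepPoly] at h1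
  exact (G.indepSum_pos_of_nonneg (not_lt.1 h) _).ne' h1

theorem le_xi_of_eval_nonpos {x : ℝ} (hx : x ≤ 0) (h : G.indepPoly.eval x ≤ 0) : x ≤ G.xi := by
  have h0 : G.indepPoly.eval 0 = 1 := by rw [eval_indepPoly, indepSum_zero]
  obtain ⟨c, hc, hc0⟩ := intermediate_value_Icc hx G.indepPoly.continuous.continuousOn
    (show (0 : ℝ) ∈ _ from ⟨h, by rw [h0]; exact zero_le_one⟩)
  have h1 := G.isSmallestRoot_xi.2 (c : ℂ) (by
    have := aeval_algebraMap_apply ℂ c G.indepPoly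
    rw [coe_aeval_eq_eval, show G.indepPoly.eval c = 0 from hc0] at this
    simpa using this)
  rw [abs_of_neg G.xi_neg, Complex.norm_real, Real.norm_eq_abs, abs_of_nonpos hc.2] at h1
  linarith [hc.1]

/-- Let `ρ` be the least `t ≥ 0` at which some induced subgraph vanishes at `-t`. All values at `-ρ`
are nonnegative, hence decrease as the vertex set grows, so the whole graph is nonpositive there.
This forces `-ρ ≤ ξ(G)`: no induced subgraph vanishes before the graph itself does. -/
theorem indepSum_pos_of_xi_lt {x : ℝ} (hx : G.xi < x) (hx0 : x ≤ 0) (S : Finset V) :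
    0 < G.indepSum x S := by
  set Z : Set ℝ := ⋃ S : Finset V, {t : ℝ | 0 ≤ t ∧ G.indepSum (-t) S = 0} with hZ
  have hclosed : IsClosed Z := by
    refine isClosed_iUnion_of_finite fun S => ?_
    exact isClosed_Ici.inter (isClosed_eq (G.continuous_indepSum S) continuous_const)
  have hbdd : BddBelow Z := ⟨0, by
    rintro t ht
    obtain ⟨S, hS⟩ := Set.mem_iUnion.1 ht
    exact hS.1⟩
  by_contra hS
  obtain ⟨c, hc, hc0⟩ := intermediate_value_Icc' (neg_nonneg.2 hx0)
    (G.continuous_indepSum S).continuousOn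
    (show (0 : ℝ) ∈ _ from ⟨by rw [neg_neg]; exact not_lt.1 hS, by simp [indepSum_zero]⟩)
  have hcZ : c ∈ Z := Set.mem_iUnion.2 ⟨S, hc.1, hc0⟩
  obtain ⟨S₀, hρ0, hρ⟩ := Set.mem_iUnion.1 (hclosed.csInf_mem ⟨c, hcZ⟩ hbdd)
  have hρc := csInf_le hbdd hcZ
  set ρ := sInf Z
  have hpos : ∀ t, 0 ≤ t → t < ρ → ∀ S, 0 ≤ G.indepSum (-t) S := by
    intro t ht htρ S
    by_contra hS
    obtain ⟨c, hc, hc0⟩ := intermediate_value_Icc' ht (G.continuous_indepSum S).continuousOn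
      (show (0 : ℝ) ∈ _ from ⟨(not_le.1 hS).le, by simp [indepSum_zero]⟩)
    exact absurd (csInf_le hbdd (Set.mem_iUnion.2 ⟨S, hc.1, hc0⟩)) (not_le.2 (hc.2.trans_lt htρ))
  have hρpos : ρ ≠ 0 := by
    intro h0
    rw [h0, neg_zero, indepSum_zero] at hρ
    exact one_ne_zero hρ
  have hnonneg : ∀ S, 0 ≤ G.indepSum (-ρ) S := by
    intro S
    have hcl : ρ ∈ closure (Set.Ico 0 ρ) := by
      rw [closure_Ico hρpos.symm]; exact ⟨hρ0, le_rfl⟩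
    have := (isClosed_Ici (a := (0 : ℝ))).preimage (G.continuous_indepSum S)
    exact closure_minimal (fun t ht => hpos t ht.1 ht.2 S) this hcl
  have h1 := G.indepSum_anti hρ0 hnonneg (Finset.subset_univ S₀)
  rw [hρ, ← eval_indepPoly] at h1
  have := G.le_xi_of_eval_nonpos (neg_nonpos.2 hρ0) h1
  linarith [hc.2]

theorem eval_pos_of_xi_lt {x : ℝ} (hx : G.xi < x) (hx0 : x ≤ 0) : 0 < G.indepPoly.eval x := by
  rw [eval_indepPoly]
  exact G.indepSum_pos_of_xi_lt hx hx0 _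

theorem neg_one_lt_of_xi_lt {x : ℝ} (hx : G.xi < x) (hx0 : x ≤ 0) : 0 < 1 + x := by
  obtain ⟨v⟩ := ‹Nonempty V›
  have := G.indepSum_pos_of_xi_lt hx hx0 {v}
  rwa [indepSum_singleton] at this

/-- An inequality between polynomials on `(ξ(G), 0]` extends to the end point. -/
theorem eval_le_eval_of_xi_le {p q : ℝ[X]}
    (h : ∀ x, G.xi < x → x ≤ 0 → p.eval x ≤ q.eval x) {x : ℝ} (hx : x ∈ Set.Icc G.xi 0) :
    p.eval x ≤ q.eval x := by
  rw [← closure_Ioc G.xi_neg.ne] at hx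
  exact closure_minimal (s := Set.Ioc G.xi 0) (t := {x | p.eval x ≤ q.eval x})
    (fun y hy => h y hy.1 hy.2) (isClosed_le p.continuous q.continuous) hx

end Positivity

/-! ### Path values. -/

section PathSequence

/-- The values `I(P_k, -s)` of the independence polynomials of the paths. -/
def pathValue (s : ℝ) : ℕ → ℝ
  | 0 => 1
  | 1 => 1 - s
  | k + 2 => pathValue s (k + 1) - s * pathValue s k

variable {s : ℝ}

/-- Cutting a path at an edge, written without `s` so that it has the shape of `join_value`. The
right side equals `p_{a+1} p_{b+1} - (p_a - p_{a+1})(p_b - p_{b+1})`. -/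
theorem pathValue_add (s : ℝ) (a b : ℕ) : pathValue s (a + b + 2) =
    pathValue s a * pathValue s (b + 1) + pathValue s (a + 1) * pathValue s b -
      pathValue s a * pathValue s b := by
  induction b using Nat.twoStepInduction with
  | zero => simp [pathValue]; ring
  | one =>
    rw [show a + 1 + 2 = (a + 1) + 2 from rfl, pathValue, pathValue]
    simp [pathValue]; ring
  | more b ih1 ih2 =>
    rw [show a + (b + 2) + 2 = (a + b + 2) + 2 from by ring, pathValue, ih1,
      show a + b + 2 + 1 = a + (b + 1) + 2 from by ring, ih2]
    simp only [pathValue]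
    ring

theorem pathValue_succ_le (hs : 0 ≤ s) {N : ℕ} (h : ∀ j ≤ N, 0 < pathValue s j) :
    pathValue s (N + 1) ≤ pathValue s N := by
  cases N with
  | zero => simp [pathValue, hs]
  | succ k =>
    have := mul_nonneg hs (h k (by omega)).le
    rw [pathValue]
    linarith

theorem pathValue_add_le_mul (hs : 0 ≤ s) {a b : ℕ} (ha : ∀ j < a, 0 < pathValue s j)
    (hb : ∀ j < b, 0 < pathValue s j) :
    pathValue s (a + b) ≤ pathValue s a * pathValue s b := by
  cases a with
  | zero => simp [pathValue]
  | succ a =>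
    cases b with
    | zero => simp [pathValue]
    | succ b =>
      have h1 := pathValue_succ_le hs (N := a) fun j hj => ha j (by omega)
      have h2 := pathValue_succ_le hs (N := b) fun j hj => hb j (by omega)
      rw [show a + 1 + (b + 1) = a + b + 2 by ring, pathValue_add]
      nlinarith [mul_nonneg (sub_nonneg.2 h1) (sub_nonneg.2 h2)]

end PathSequence

/-! ### Trees compared with paths and stars. -/

section TreeOn

variable {V : Type*} {G : SimpleGraph V}

/-- The set `S` induces a tree in `G`: it arises from a single vertex by adding leaves. -/
inductive TreeOn (G : SimpleGraph V) : Finset V → Prop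
  | single (v : V) : TreeOn G {v}
  | leaf {S : Finset V} {u y : V} (hS : TreeOn G S) (hu : u ∈ S) (hy : y ∉ S)
      (h : ∀ z ∈ S, G.Adj y z ↔ z = u) : TreeOn G (insert y S)

theorem TreeOn.congr {G' : SimpleGraph V} {S : Finset V} (hS : G.TreeOn S)
    (h : ∀ a ∈ S, ∀ b ∈ S, G.Adj a b ↔ G'.Adj a b) : G'.TreeOn S := by
  induction hS with
  | single v => exact .single v
  | leaf hS hu hy hyz ih =>
    refine .leaf (ih fun a ha b hb => h a (by simp [ha]) b (by simp [hb])) hu hy fun z hz => ?_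
    rw [← hyz z hz, h _ (by simp) z (by simp [hz])]

/-- The first edge on the path from `r` to `v` splits a tree. -/
theorem TreeOn.split {S : Finset V} (hS : G.TreeOn S) {r v : V} (hr : r ∈ S) (hv : v ∈ S)
    (hne : r ≠ v) : ∃ (A B : Finset V) (y : V), A ∪ B = S ∧ Disjoint A B ∧ G.TreeOn A ∧
      G.TreeOn B ∧ r ∈ A ∧ v ∈ B ∧ y ∈ B ∧ ∀ a ∈ A, ∀ b ∈ B, G.Adj a b ↔ a = r ∧ b = y := by
  induction hS generalizing r v with
  | single w =>
    rw [Finset.mem_singleton] at hr hv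
    exact absurd (hr.trans hv.symm) hne
  | @leaf S u y hS hu hy h ih =>
    rcases Finset.mem_insert.1 hr with rfl | hrS
    · rcases Finset.mem_insert.1 hv with rfl | hvS
      · exact absurd rfl hne
      refine ⟨{r}, S, u, by simp, by simpa using hy, .single r, hS, by simp, hvS, hu, ?_⟩
      intro a ha b hb
      obtain rfl := Finset.mem_singleton.1 ha
      simp [h b hb]
    -- Here `w` is the target inside `S`: either `v` itself, or the neighbour `u` of the new leaf
    -- when `v` is that leaf. The leaf joins the side that contains `u`.
    have key : ∀ w ∈ S, r ≠ w → (v = w ∨ v = y ∧ w = u) → ∃ (A B : Finset V) (z : V),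
        A ∪ B = insert y S ∧ Disjoint A B ∧ G.TreeOn A ∧ G.TreeOn B ∧ r ∈ A ∧ v ∈ B ∧ z ∈ B ∧
          ∀ a ∈ A, ∀ b ∈ B, G.Adj a b ↔ a = r ∧ b = z := by
      intro w hw hrw hvw
      obtain ⟨A, B, z, rfl, hd, hA, hB, hrA, hwB, hzB, hab⟩ := ih hrS hw hrw
      rw [Finset.mem_union, not_or] at hy
      have hd' := Finset.disjoint_left.1 hd
      by_cases huA : u ∈ A
      · have hvB : v ∈ B := by
          rcases hvw with rfl | ⟨-, rfl⟩
          · exact hwB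
          · exact absurd hwB (hd' huA)
        refine ⟨insert y A, B, z, by rw [Finset.insert_union], ?_, .leaf hA huA hy.1
          fun x hx => h x (by simp [hx]), hB, by simp [hrA], hvB, hzB, ?_⟩
        · rw [Finset.disjoint_insert_left]; exact ⟨hy.2, hd⟩
        · intro a ha b hb
          rcases Finset.mem_insert.1 ha with rfl | ha
          · rw [h b (by simp [hb])]
            refine iff_of_false ?_ ?_
            · rintro rfl; exact hd' huA hb
            · rintro ⟨rfl, -⟩; exact hy.1 hrA
          · exact hab a ha b hb
      · have huB : u ∈ B := (Finset.mem_union.1 hu).resolve_left huA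
        refine ⟨A, insert y B, z, by rw [Finset.union_insert], ?_, hA, .leaf hB huB hy.2
          fun x hx => h x (by simp [hx]), hrA, ?_, by simp [hzB], ?_⟩
        · rw [Finset.disjoint_insert_right]; exact ⟨hy.1, hd⟩
        · rcases hvw with rfl | ⟨rfl, -⟩
          · simp [hwB]
          · simp
        · intro a ha b hb
          rcases Finset.mem_insert.1 hb with rfl | hb
          · rw [G.adj_comm, h a (by simp [ha])]
            refine iff_of_false ?_ ?_
            · rintro rfl; exact huA ha
            · rintro ⟨-, rfl⟩; exact hy.2 hzB
          · exact hab a ha b hb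
    rcases Finset.mem_insert.1 hv with rfl | hvS
    · by_cases hru : r = u
      · subst hru
        refine ⟨S, {v}, v, by rw [Finset.union_comm]; rfl, by simpa using hy, hS, .single v, hrS,
          by simp, by simp, ?_⟩
        intro a ha b hb
        obtain rfl := Finset.mem_singleton.1 hb
        simp [G.adj_comm a, h a ha]
      · exact key u hu hru (Or.inr ⟨rfl, rfl⟩)
    · exact key v hvS hne (Or.inl rfl)

theorem TreeOn.nonempty {S : Finset V} (hS : G.TreeOn S) : S.Nonempty := by
  cases hS <;> simp

theorem TreeOn.exists_card {S : Finset V} (hS : G.TreeOn S) {m : ℕ} (h : S.card = m + 2) :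
    ∃ T, G.TreeOn T ∧ T.card = m + 1 := by
  cases hS with
  | single v => simp at h
  | leaf hS hu hy _ =>
    refine ⟨_, hS, ?_⟩
    rw [Finset.card_insert_of_notMem hy] at h
    omega

variable {s : ℝ}

theorem join_value {A B : Finset V} {x y : V} (hd : Disjoint A B) (hx : x ∈ A)
    (h : ∀ a ∈ A, ∀ b ∈ B, G.Adj a b ↔ a = x ∧ b = y) (t : ℝ) :
    G.indepSum t (A ∪ B) = G.indepSum t (A.erase x) * G.indepSum t B -
      (G.indepSum t (A.erase x) - G.indepSum t A) * G.indepSum t (B.erase y) := by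
  rw [indepSum_join G t hd hx fun a ha b hb hab => ((h a ha b hb).1 hab).1,
    show (B.filter fun b => ¬ G.Adj x b) = B.erase y from ?_]
  · ring
  · ext b
    rw [Finset.mem_filter, Finset.mem_erase, and_comm]
    refine and_congr_left fun hb => ?_
    rw [h x hx b hb]
    simp

/-- Divided by `YA * XB`, the value of the joined tree is `1 - (1 - XA/YA)(YB/XB)`, which is
increasing in both ratios `XA/YA` and `XB/YB`; each is replaced by its bound for paths. -/
theorem join_ratio {XA YA XB YB pa pa' pb pb' pN : ℝ} (hXB : 0 ≤ XB) (hXA : XA ≤ YA)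
    (hpa : 0 < pa) (hpb : 0 < pb) (hA : XA * pa ≤ pa' * YA) (hB : XB * pb ≤ pb' * YB)
    (hN : pN = pa * pb' + pa' * pb - pa * pb) :
    (YA * XB - (YA - XA) * YB) * (pa * pb') ≤ pN * (YA * XB) := by
  have h1 := mul_le_mul_of_nonneg_left hB (mul_nonneg (sub_nonneg.2 hXA) hpa.le)
  have h2 := mul_le_mul_of_nonneg_left hA (mul_nonneg hXB hpb.le)
  subst hN
  nlinarith

/-- The values of a tree at `-s` are at most those of the path with as many vertices. -/
theorem TreeOn.bounds (hs : 0 ≤ s) (hpos : ∀ T, 0 < G.indepSum (-s) T) {S : Finset V}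
    (hS : G.TreeOn S) {m : ℕ} (hm : S.card = m + 1) :
    (∀ j ≤ m + 1, 0 < pathValue s j) ∧ G.indepSum (-s) S ≤ pathValue s (m + 1) ∧
      ∀ u ∈ S, G.indepSum (-s) S * pathValue s m ≤
        pathValue s (m + 1) * G.indepSum (-s) (S.erase u) := by
  induction m using Nat.strong_induction_on generalizing S with
  | _ m ih =>
    have hanti : ∀ {A B : Finset V}, A ⊆ B → G.indepSum (-s) B ≤ G.indepSum (-s) A :=
      fun h => G.indepSum_anti hs (fun T => (hpos T).le) h
    cases m with
    | zero =>
      obtain ⟨v, rfl⟩ := Finset.card_eq_one.1 hm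
      have hv := hpos {v}
      rw [indepSum_singleton] at hv ⊢
      refine ⟨fun j hj => ?_, by simp [pathValue, sub_eq_add_neg], fun u hu => ?_⟩
      · interval_cases j
        · simp [pathValue]
        · simpa [pathValue, sub_eq_add_neg] using hv
      · obtain rfl := Finset.mem_singleton.1 hu
        simp [pathValue, indepSum_empty, sub_eq_add_neg]
    | succ k =>
      -- Positivity of the path values is not assumed: a smaller tree supplies it up to `k + 1`, and
      -- `hr` below then gives it for `k + 2`.
      obtain ⟨T, hT, hTk⟩ := hS.exists_card hm
      have hp : ∀ j ≤ k + 1, 0 < pathValue s j := (ih k (by omega) hT hTk).1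
      have main : ∀ u ∈ S, 0 < pathValue s (k + 2) ∧ G.indepSum (-s) S ≤ pathValue s (k + 2) ∧
          G.indepSum (-s) S * pathValue s (k + 1) ≤
            pathValue s (k + 2) * G.indepSum (-s) (S.erase u) := by
        intro u hu
        obtain ⟨v, hv, hvu⟩ := Finset.exists_mem_ne (by omega : 1 < S.card) u
        obtain ⟨A, B, y, rfl, hd, hA, hB, huA, hvB, hyB, hab⟩ := hS.split hu hv hvu.symm
        obtain ⟨a, ha⟩ := Nat.exists_eq_succ_of_ne_zero hA.nonempty.card_pos.ne'
        obtain ⟨b, hb⟩ := Nat.exists_eq_succ_of_ne_zero hB.nonempty.card_pos.ne'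
        rw [Finset.card_union_of_disjoint hd] at hm
        obtain rfl : k = a + b := by omega
        obtain ⟨-, hA1, hA2⟩ := ih a (by omega) hA ha
        obtain ⟨-, hB1, hB2⟩ := ih b (by omega) hB hb
        have huB : u ∉ B := Finset.disjoint_left.1 hd huA
        have hT : G.indepSum (-s) ((A ∪ B).erase u) =
            G.indepSum (-s) (A.erase u) * G.indepSum (-s) B := by
          rw [Finset.erase_union_distrib, Finset.erase_eq_of_notMem huB]
          refine indepSum_union G _ (hd.mono_left (Finset.erase_subset u A)) fun z hz w hw hzw => ?_
          exact Finset.ne_of_mem_erase hz ((hab z (Finset.mem_of_mem_erase hz) w hw).1 hzw).1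
        have hX := hpos (A ∪ B)
        have hA3 := hanti (Finset.erase_subset u A)
        have hB3 := hanti (Finset.erase_subset y B)
        rw [hT]
        rw [join_value hd huA hab] at hX ⊢
        have hA2 := hA2 u huA
        have hB2 := hB2 y hyB
        have qA := hpos A
        have qB := hpos B
        have qA' := hpos (A.erase u)
        have pa := hp a (by omega)
        have pb := hp b (by omega)
        have pa' := hp (a + 1) (by omega)
        have pb' := hp (b + 1) (by omega)
        have ma := pathValue_succ_le hs (N := a) fun j hj => hp j (by omega)
        have mb := pathValue_succ_le hs (N := b) fun j hj => hp j (by omega)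
        -- For the ratio bound: by submultiplicativity the path is extremal when the deleted vertex
        -- is one of its ends.
        have hsub := pathValue_add_le_mul hs (a := a) (b := b + 1) (fun j hj => hp j (by omega))
          fun j hj => hp j (by omega)
        have hN := pathValue_add s a b
        have hr := join_ratio qB.le hA3 pa pb hA2 hB2 hN
        generalize G.indepSum (-s) A = XA at *
        generalize G.indepSum (-s) B = XB at *
        generalize G.indepSum (-s) (A.erase u) = YA at *
        generalize G.indepSum (-s) (B.erase y) = YB at *
        rw [show a + (b + 1) = a + b + 1 by ring] at hsub
        generalize pathValue s (a + b + 2) = pN at *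
        have hN0 : 0 < pN := by
          have : 0 < pN * (YA * XB) := lt_of_lt_of_le (by positivity) hr
          exact pos_of_mul_pos_left this (by positivity)
        refine ⟨hN0, ?_, ?_⟩
        -- The joined value is `XA XB - (YA - XA)(YB - XB)`. The ratio bounds make its quotient by
        -- `XA XB` at most that of the path, and `XA`, `XB` are themselves at most the path values.
        · have h1 : XA * (pathValue s a - pathValue s (a + 1)) ≤ (YA - XA) * pathValue s (a + 1) := by
            linarith
          have h2 : XB * (pathValue s b - pathValue s (b + 1)) ≤ (YB - XB) * pathValue s (b + 1) := by
            linarith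
          have h3 := mul_le_mul h1 h2 (mul_nonneg qB.le (sub_nonneg.2 mb))
            (mul_nonneg (sub_nonneg.2 hA3) pa'.le)
          have h4 : XA * XB * pN ≤ pathValue s (a + 1) * pathValue s (b + 1) * pN :=
            mul_le_mul_of_nonneg_right (mul_le_mul hA1 hB1 qB.le pa'.le) hN0.le
          refine le_of_mul_le_mul_left ?_ (mul_pos pa' pb')
          rw [hN] at h4 ⊢
          linarith
        · exact (mul_le_mul_of_nonneg_left hsub hX.le).trans hr
      obtain ⟨u, hu⟩ := hS.nonempty
      refine ⟨fun j hj => ?_, (main u hu).2.1, fun u hu => (main u hu).2.2⟩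
      rcases Nat.lt_or_ge j (k + 2) with h | h
      · exact hp j (by omega)
      · obtain rfl : j = k + 2 := by omega
        exact (main u hu).1

/-- The extremal case is the path with both ends deleted. Split at `x` towards `v`, multiply the
ratio from `join_ratio` by the ratio of `B` at `v`, and use submultiplicativity of path values. -/
theorem TreeOn.pair_bound (hs : 0 ≤ s) (hpos : ∀ T, 0 < G.indepSum (-s) T) {S : Finset V}
    (hS : G.TreeOn S) {m : ℕ} (hm : S.card = m + 2) {x v : V} (hx : x ∈ S) (hv : v ∈ S)
    (hxv : x ≠ v) : G.indepSum (-s) S * pathValue s m ≤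
      pathValue s (m + 2) * G.indepSum (-s) ((S.erase x).erase v) := by
  have hp := (hS.bounds hs hpos hm).1
  obtain ⟨A, B, y, rfl, hd, hA, hB, hxA, hvB, hyB, hab⟩ := hS.split hx hv hxv
  obtain ⟨a, ha⟩ := Nat.exists_eq_succ_of_ne_zero hA.nonempty.card_pos.ne'
  obtain ⟨b, hb⟩ := Nat.exists_eq_succ_of_ne_zero hB.nonempty.card_pos.ne'
  rw [Finset.card_union_of_disjoint hd] at hm
  obtain rfl : m = a + b := by omega
  have hA2 := (hA.bounds hs hpos ha).2.2 x hxA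
  have hB2 := (hB.bounds hs hpos hb).2.2 y hyB
  have hB2' := (hB.bounds hs hpos hb).2.2 v hvB
  have hxB : x ∉ B := Finset.disjoint_left.1 hd hxA
  have hvA : v ∉ A := Finset.disjoint_right.1 hd hvB
  have hT : G.indepSum (-s) (((A ∪ B).erase x).erase v) =
      G.indepSum (-s) (A.erase x) * G.indepSum (-s) (B.erase v) := by
    rw [Finset.erase_union_distrib, Finset.erase_eq_of_notMem hxB, Finset.erase_union_distrib,
      Finset.erase_eq_of_notMem fun h => hvA (Finset.mem_of_mem_erase h)]
    refine indepSum_union G _ (hd.mono (Finset.erase_subset x A) (Finset.erase_subset v B))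
      fun z hz w hw hzw => ?_
    exact Finset.ne_of_mem_erase hz
      ((hab z (Finset.mem_of_mem_erase hz) w (Finset.mem_of_mem_erase hw)).1 hzw).1
  have hX := hpos (A ∪ B)
  have hA3 := G.indepSum_anti hs (fun T => (hpos T).le) (Finset.erase_subset x A)
  rw [hT]
  rw [join_value hd hxA hab] at hX ⊢
  have hr := join_ratio (hpos B).le hA3 (hp a (by omega)) (hp b (by omega)) hA2 hB2
    (pathValue_add s a b)
  have hsub := pathValue_add_le_mul hs (a := a) (b := b) (fun j hj => hp j (by omega))
    fun j hj => hp j (by omega)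
  have pN := hp (a + b + 2) (by omega)
  have pb' := hp (b + 1) (by omega)
  have pb := hp b (by omega)
  have qA' := hpos (A.erase x)
  have h1 := mul_le_mul_of_nonneg_right hr pb.le
  have h2 := mul_le_mul_of_nonneg_left hB2' (mul_pos pN qA').le
  have h3 := mul_le_mul_of_nonneg_left hsub (mul_pos hX pb').le
  refine le_of_mul_le_mul_left ?_ pb'
  linarith

/-- The values of a tree at `-s` are at least those of the star with as many vertices. -/
theorem TreeOn.star_le (hs : 0 ≤ s) (hs1 : s ≤ 1) (hpos : ∀ T, 0 < G.indepSum (-s) T)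
    {S : Finset V} (hS : G.TreeOn S) {m : ℕ} (hm : S.card = m + 1) :
    (1 - s) ^ m - s ≤ G.indepSum (-s) S := by
  induction hS generalizing m with
  | single v =>
    obtain rfl : m = 0 := by simpa using hm.symm
    rw [indepSum_singleton]; simp
  | @leaf S u y hS hu hy h ih =>
    rw [Finset.card_insert_of_notMem hy] at hm
    have hS0 := hS.nonempty.card_pos
    obtain ⟨k, rfl⟩ := Nat.exists_eq_succ_of_ne_zero (show m ≠ 0 by omega)
    have h1 := ih (m := k) (by omega)
    have h2 := G.indepSum_le_pow hs hs1 (fun T => (hpos T).le) (S.erase u)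
    rw [Finset.card_erase_of_mem hu, show S.card - 1 = k by omega] at h2
    rw [indepSum_insert G _ hy, show (S.filter fun z => ¬ G.Adj y z) = S.erase u from ?_]
    -- The leaf subtracts `s` times the value of `S` without `u`, at most `s (1 - s)^k`; starting
    -- from `(1 - s)^k - s` this leaves exactly `(1 - s)^(k+1) - s`.
    · rw [pow_succ]
      nlinarith [mul_le_mul_of_nonneg_left h2 hs]
    · ext b
      rw [Finset.mem_filter, Finset.mem_erase, and_comm]
      exact and_congr_left fun hb => not_congr (h b hb)

end TreeOn

/-! ### Two trees joined by two edges at one vertex. -/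

section Unicyclic

variable {V : Type*} {G : SimpleGraph V} {s : ℝ} {A B : Finset V} {u x v : V}

theorem unicyclic_value (hd : Disjoint A B) (hu : u ∈ A)
    (h : ∀ a ∈ A, ∀ b ∈ B, G.Adj a b ↔ a = u ∧ (b = x ∨ b = v)) (t : ℝ) :
    G.indepSum t (A ∪ B) = G.indepSum t (A.erase u) * G.indepSum t B -
      (G.indepSum t (A.erase u) - G.indepSum t A) * G.indepSum t ((B.erase x).erase v) := by
  rw [indepSum_join G t hd hu fun a ha b hb hab => ((h a ha b hb).1 hab).1,
    show (B.filter fun b => ¬ G.Adj u b) = (B.erase x).erase v from ?_]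
  · ring
  · ext b
    rw [Finset.mem_filter, Finset.mem_erase, Finset.mem_erase]
    constructor
    · rintro ⟨hb, hub⟩
      rw [h u hu b hb] at hub
      simp only [true_and, not_or] at hub
      exact ⟨hub.2, hub.1, hb⟩
    · rintro ⟨h1, h2, hb⟩
      rw [h u hu b hb]
      simp [h1, h2, hb]

/-- The bounds for `A` and `B` first give `p_{m+2} - s p_a p_b`, the value of a cycle on `b + 3`
vertices with a path of `a` further vertices attached. Since `p_{a+b} ≤ p_a p_b`, this is at most
the value of the cycle on all vertices. -/
theorem unicyclic_le (hs : 0 ≤ s) (hpos : ∀ T, 0 < G.indepSum (-s) T) (hd : Disjoint A B)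
    (hA : G.TreeOn A) (hB : G.TreeOn B) (hu : u ∈ A) (hx : x ∈ B) (hv : v ∈ B) (hxv : x ≠ v)
    (h : ∀ a ∈ A, ∀ b ∈ B, G.Adj a b ↔ a = u ∧ (b = x ∨ b = v)) {m : ℕ}
    (hm : (A ∪ B).card = m + 3) :
    G.indepSum (-s) (A ∪ B) ≤ pathValue s (m + 2) - s * pathValue s m := by
  obtain ⟨a, ha⟩ := Nat.exists_eq_succ_of_ne_zero hA.nonempty.card_pos.ne'
  obtain ⟨b, hb⟩ : ∃ b, B.card = b + 2 :=
    ⟨B.card - 2, by have := Finset.one_lt_card.2 ⟨x, hx, v, hv, hxv⟩; omega⟩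
  rw [Finset.card_union_of_disjoint hd] at hm
  obtain rfl : m = a + b := by omega
  obtain ⟨pA, hA1, hA2⟩ := hA.bounds hs hpos ha
  obtain ⟨pB, hB1, -⟩ := hB.bounds hs hpos hb
  have hA2 := hA2 u hu
  have hB2 := hB.pair_bound hs hpos hb hx hv hxv
  have hX := hpos (A ∪ B)
  have hA3 := G.indepSum_anti hs (fun T => (hpos T).le) (Finset.erase_subset u A)
  rw [unicyclic_value hd hu h] at hX ⊢
  have pa := pA a (by omega)
  have pa' := pA (a + 1) (by omega)
  have pb := pB b (by omega)
  have pb' := pB (b + 1) (by omega)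
  have pb'' := pB (b + 2) (by omega)
  have mb := pathValue_succ_le hs (N := b) fun j hj => pB j (by omega)
  have mb' := pathValue_succ_le hs (N := b + 1) fun j hj => pB j (by omega)
  have hN := pathValue_add s a b
  have hb2 : pathValue s (b + 2) = pathValue s (b + 1) - s * pathValue s b := rfl
  have hsub : s * pathValue s (a + b) ≤ s * (pathValue s a * pathValue s b) := by
    exact mul_le_mul_of_nonneg_left (pathValue_add_le_mul hs (fun j hj => pA j (by omega))
      fun j hj => pB j (by omega)) hs
  have qA := hpos A
  have qB := hpos B
  generalize G.indepSum (-s) A = XA at *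
  generalize G.indepSum (-s) B = XB at *
  generalize G.indepSum (-s) (A.erase u) = YA at *
  generalize G.indepSum (-s) ((B.erase x).erase v) = Z at *
  set p := pathValue s a
  set p' := pathValue s (a + 1)
  set q := pathValue s b
  set q'' := pathValue s (b + 2)
  have h1 : (YA * XB - (YA - XA) * Z) * (p' * q'') ≤ XA * XB * (p * q'' - (p - p') * q) := by
    have e1 := mul_le_mul_of_nonneg_left hB2 (mul_nonneg (sub_nonneg.2 hA3) pa'.le)
    have e2 := mul_le_mul_of_nonneg_left hA2
      (mul_nonneg qB.le (sub_nonneg.2 (mb'.trans mb) : 0 ≤ q - q''))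
    nlinarith
  have hK : 0 < p * q'' - (p - p') * q := by
    have : 0 < XA * XB * (p * q'' - (p - p') * q) := lt_of_lt_of_le (by positivity) h1
    exact pos_of_mul_pos_right this (by positivity)
  have h2 : YA * XB - (YA - XA) * Z ≤ p * q'' - (p - p') * q := by
    refine le_of_mul_le_mul_right (h1.trans ?_) (mul_pos pa' pb'')
    rw [mul_comm (p * q'' - _)]
    exact mul_le_mul_of_nonneg_right (mul_le_mul hA1 hB1 qB.le pa'.le) hK.le
  rw [hN]
  nlinarith

theorem le_unicyclic (hs : 0 ≤ s) (hs1 : s ≤ 1) (hpos : ∀ T, 0 < G.indepSum (-s) T)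
    (hd : Disjoint A B) (hB : G.TreeOn B) (hu : u ∈ A) (hx : x ∈ B) (hv : v ∈ B) (hxv : x ≠ v)
    (hA : G.TreeOn A)
    (h : ∀ a ∈ A, ∀ b ∈ B, G.Adj a b ↔ a = u ∧ (b = x ∨ b = v)) {m : ℕ}
    (hm : (A ∪ B).card = m + 3) :
    (1 - 2 * s) * (1 - s) ^ m - s ≤ G.indepSum (-s) (A ∪ B) := by
  obtain ⟨a, ha⟩ := Nat.exists_eq_succ_of_ne_zero hA.nonempty.card_pos.ne'
  obtain ⟨b, hb⟩ : ∃ b, B.card = b + 2 :=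
    ⟨B.card - 2, by have := Finset.one_lt_card.2 ⟨x, hx, v, hv, hxv⟩; omega⟩
  rw [Finset.card_union_of_disjoint hd] at hm
  obtain rfl : m = a + b := by omega
  have hn := fun T => (hpos T).le
  have hA1 := hA.star_le hs hs1 hpos ha
  have hB1 := hB.star_le hs hs1 hpos hb
  have hA3 := G.indepSum_anti hs hn (Finset.erase_subset u A)
  have hZ := G.indepSum_le_pow hs hs1 hn ((B.erase x).erase v)
  have hvx : v ∈ B.erase x := Finset.mem_erase.2 ⟨hxv.symm, hv⟩
  rw [Finset.card_erase_of_mem hvx, Finset.card_erase_of_mem hx, hb] at hZ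
  have hZ' := G.indepSum_anti hs hn
    ((Finset.erase_subset v (B.erase x)).trans (Finset.erase_subset x B))
  have hD : G.indepSum (-s) (A.erase u) - G.indepSum (-s) A ≤ s := by
    rw [indepSum_eq_erase G _ hu]
    have := mul_le_mul_of_nonneg_left
      (G.indepSum_le_one hs hn ((A.erase u).filter fun w => ¬ G.Adj u w)) hs
    linarith
  rw [unicyclic_value hd hu h]
  have qB := hpos B
  have r1 : (0 : ℝ) ≤ 1 - (1 - s) ^ a := sub_nonneg.2 (pow_le_one₀ (by linarith) (by linarith))
  have r2 : (0 : ℝ) ≤ 1 - (1 - s) ^ b := sub_nonneg.2 (pow_le_one₀ (by linarith) (by linarith))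
  have r3 : (0 : ℝ) ≤ (1 - s) ^ a := pow_nonneg (by linarith) a
  simp only [show b + 2 - 1 - 1 = b by omega] at hZ
  rw [pow_add]
  rw [pow_succ] at hB1
  generalize G.indepSum (-s) A = XA at *
  generalize G.indepSum (-s) B = XB at *
  generalize G.indepSum (-s) (A.erase u) = YA at *
  generalize G.indepSum (-s) ((B.erase x).erase v) = Z at *
  have e1 := mul_le_mul_of_nonneg_right hD (sub_nonneg.2 hZ')
  have e2 := mul_le_mul_of_nonneg_left hA1 qB.le
  have e3 := mul_le_mul_of_nonneg_left hB1 r3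
  have e4 := mul_le_mul_of_nonneg_left hZ hs
  -- The value is at least `(1 - s)^a XB - s Z`. After the bounds on `XB` and `Z`, the excess over
  -- the target is `s (1 - (1 - s)^a)(1 - (1 - s)^b)`.
  nlinarith [mul_nonneg hs (mul_nonneg r1 r2)]

end Unicyclic

theorem indepSum_eq_add {V : Type*} (G : SimpleGraph V) {R : Type*} [CommRing R] (x : R)
    {S T U : Finset V} {v : V} (hv : v ∉ S) (hT : ∀ u, u ∈ T ↔ u = v ∨ u ∈ S)
    (hU : ∀ u, u ∈ U ↔ u ∈ S ∧ ¬ G.Adj v u) :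
    G.indepSum x T = G.indepSum x S + x * G.indepSum x U := by
  rw [show T = insert v S by ext; simp [hT], indepSum_insert G x hv,
    show U = S.filter fun u => ¬ G.Adj v u by ext; simp [hU]]

/-! ### Values of the two extremal graphs. -/

section Cycle

theorem cycleGraph_adj_iff {n : ℕ} {u v : Fin n} (h : v.val < u.val) :
    (cycleGraph n).Adj u v ↔ v.val + 1 = u.val ∨ v.val = 0 ∧ u.val + 1 = n := by
  have hv := u.2
  rw [adj_comm, cycleGraph_adj', Fin.sub_val_of_le (Fin.le_def.2 h.le), Fin.val_sub,
    Nat.mod_eq_of_lt (by omega)]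
  omega

/-- A proper interval of the cycle induces a path; the hypothesis `h` excludes the interval
containing both ends of the wrap-around edge. -/
theorem indepSum_cycleGraph_interval (s : ℝ) {n a k : ℕ} (hk : a + k ≤ n) (h : 0 < a ∨ k < n) :
    (cycleGraph n).indepSum (-s) (Finset.univ.filter fun i => a ≤ i.val ∧ i.val < a + k) =
      pathValue s k := by
  induction k using Nat.twoStepInduction with
  | zero =>
    rw [Finset.filter_false_of_mem (fun i _ => by omega), indepSum_empty, pathValue]
  | one =>
    rw [show (Finset.univ.filter fun i : Fin n => a ≤ i.val ∧ i.val < a + 1) = {⟨a, by omega⟩} by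
      ext i; simp [Fin.ext_iff]; omega, indepSum_singleton, pathValue]
    ring
  | more k ih1 ih2 =>
    rw [pathValue, ← ih1 (by omega) (by omega), ← ih2 (by omega) (by omega), sub_eq_add_neg,
      ← neg_mul]
    refine indepSum_eq_add _ _ (v := ⟨a + k + 1, by omega⟩) (by simp; omega) (fun i => ?_)
      (fun i => ?_)
    · simp [Fin.ext_iff]; omega
    · simp only [Finset.mem_filter, Finset.mem_univ, true_and]
      constructor
      · intro h1
        rw [cycleGraph_adj_iff (by simp; omega)]
        simp
        omega
      · rintro ⟨h1, h2⟩
        rw [cycleGraph_adj_iff (by simp; omega)] at h2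
        simp at h2
        omega

theorem indepSum_cycleGraph (s : ℝ) (m : ℕ) :
    (cycleGraph (m + 3)).indepSum (-s) Finset.univ = pathValue s (m + 2) - s * pathValue s m := by
  rw [← indepSum_cycleGraph_interval s (n := m + 3) (a := 1) (k := m) (by omega) (by omega),
    ← indepSum_cycleGraph_interval s (n := m + 3) (a := 0) (k := m + 2) (by omega) (by omega),
    sub_eq_add_neg, ← neg_mul]
  refine indepSum_eq_add _ _ (v := ⟨m + 2, by omega⟩) (by simp) (fun i => ?_) (fun i => ?_)
  · simp [Fin.ext_iff]; omega
  · simp only [Finset.mem_filter, Finset.mem_univ, true_and]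
    constructor
    · intro h1
      rw [cycleGraph_adj_iff (by simp; omega)]
      dsimp only
      omega
    · rintro ⟨h1, h2⟩
      rw [cycleGraph_adj_iff (by simp; omega)] at h2
      dsimp only at h2
      omega

end Cycle

section TriangleStar

theorem indepSum_triangleStar (x : ℝ) (m : ℕ) :
    (triangleStar (m + 3)).indepSum x Finset.univ = (1 + 2 * x) * (1 + x) ^ m + x := by
  have hadj : ∀ i j : Fin (m + 3), (triangleStar (m + 3)).Adj i j ↔
      i.val ≠ j.val ∧ ((i.val = 0 ∨ (i.val = 1 ∧ j.val = 2)) ∨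
        (j.val = 0 ∨ (j.val = 1 ∧ i.val = 2))) := fun i j => by
    rw [← Fin.ext_iff.ne]; exact fromRel_adj _ i j
  have hcard : ∀ k ≤ 3, (Finset.univ.filter fun i : Fin (m + 3) => k ≤ i.val).card = m + 3 - k := by
    intro k hk
    have h1 := Finset.card_filter_add_card_filter_not (s := Finset.univ)
      fun i : Fin (m + 3) => i.val < k
    rw [Fin.card_filter_val_lt, Finset.card_univ, Fintype.card_fin] at h1
    simp only [not_lt] at h1
    omega
  have hI : ∀ k, 2 ≤ k → k ≤ 3 → (triangleStar (m + 3)).indepSum x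
      (Finset.univ.filter fun i : Fin (m + 3) => k ≤ i.val) = (1 + x) ^ (m + 3 - k) := by
    intro k h2 h3
    rw [indepSum_eq_pow, hcard k h3]
    intro i hi j hj
    simp only [Finset.mem_filter, Finset.mem_univ, true_and] at hi hj
    rw [hadj]
    omega
  rw [indepSum_eq_add _ x (S := Finset.univ.filter fun i : Fin (m + 3) => 1 ≤ i.val) (U := ∅)
      (v := ⟨0, by omega⟩) (by simp) (fun i => by
        simp only [Fin.ext_iff, Finset.mem_filter, Finset.mem_univ, true_and, true_iff]; omega)
      (fun i => iff_of_false (Finset.notMem_empty i) fun h => h.2 <| (hadj _ _).2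
        ⟨Nat.ne_of_lt (Finset.mem_filter.1 h.1).2, Or.inl (Or.inl rfl)⟩),
    indepSum_eq_add _ x (S := Finset.univ.filter fun i : Fin (m + 3) => 2 ≤ i.val)
      (U := Finset.univ.filter fun i : Fin (m + 3) => 3 ≤ i.val)
      (v := ⟨1, by omega⟩) (by simp) (fun i => by
        simp only [Fin.ext_iff, Finset.mem_filter, Finset.mem_univ, true_and]; omega)
      (fun i => by
        simp only [hadj, Finset.mem_filter, Finset.mem_univ, true_and]
        omega), hI 2 le_rfl (by omega), hI 3 (by omega) le_rfl,
    indepSum_empty, show m + 3 - 2 = m + 1 by omega, Nat.add_sub_cancel]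
  ring

end TriangleStar

/-! ### Coronas and the substitution `x/(1 + x)`. -/

section GraphStar

variable {V : Type*} (G : SimpleGraph V) {x : ℝ}

/-- Choosing a base vertex removes its pendant vertex, while every other pendant remains free with
weight `1 + x`. Separate sets `J ⊆ S` are needed because deleting a base vertex keeps its pendant.
-/
theorem indepSum_graphStar (hx : 1 + x ≠ 0) (J S : Finset V) (hJ : J ⊆ S) :
    G.graphStar.indepSum x (J.disjSum S) =
      (1 + x) ^ S.card * G.indepSum (x / (1 + x)) J := by
  induction hn : J.card using Nat.strong_induction_on generalizing J S with
  | _ n ih =>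
    subst hn
    rcases J.eq_empty_or_nonempty with rfl | ⟨v, hv⟩
    · rw [indepSum_empty, mul_one, indepSum_eq_pow]
      · simp
      · rintro (u | u) hu (w | w) hw
        · simp at hu
        · simp at hu
        · simp at hw
        · exact id
    have hlt := Finset.card_erase_lt_of_mem hv
    have hvS := hJ hv
    rw [indepSum_eq_add _ x (v := Sum.inl v) (S := (J.erase v).disjSum S)
        (U := ((J.erase v).filter fun u => ¬ G.Adj v u).disjSum (S.erase v)) (by simp) ?_ ?_,
      ih _ hlt _ _ ((Finset.erase_subset v J).trans hJ) rfl,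
      ih _ ((Finset.card_le_card (Finset.filter_subset _ _)).trans_lt hlt) _ _
        ((Finset.filter_subset _ _).trans (Finset.erase_subset_erase v hJ)) rfl,
      indepSum_eq_erase G _ hv]
    · obtain ⟨k, hk⟩ := Nat.exists_eq_succ_of_ne_zero (Finset.card_pos.2 ⟨v, hvS⟩).ne'
      rw [Finset.card_erase_of_mem hvS, hk, Nat.succ_eq_add_one, Nat.add_sub_cancel, pow_succ]
      field_simp
    · rintro (u | u)
      · by_cases h : u = v <;> simp [h, hv]
      · simp
    · rintro (u | u)
      · change _ ↔ _ ∧ ¬ G.Adj v u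
        simp
      · change _ ↔ _ ∧ ¬ v = u
        simp [and_comm, eq_comm]

theorem eval_graphStar [Fintype V] (hx : 1 + x ≠ 0) : G.graphStar.indepPoly.eval x =
    (1 + x) ^ Fintype.card V * G.indepSum (x / (1 + x)) Finset.univ := by
  rw [eval_indepPoly, ← Finset.card_univ, ← indepSum_graphStar G hx _ _ (Finset.Subset.refl _)]
  congr 1

theorem indepSum_pos_of_graphStar [Fintype V] [Nonempty V] (hx : G.graphStar.xi < x)
    (hx0 : x ≤ 0) (S : Finset V) : 0 < G.indepSum (x / (1 + x)) S := by
  have h1 := neg_one_lt_of_xi_lt _ hx hx0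
  have := indepSum_pos_of_xi_lt _ hx hx0 (S.disjSum S)
  rw [indepSum_graphStar G h1.ne' _ _ (Finset.Subset.refl _)] at this
  exact pos_of_mul_pos_right this (pow_pos h1 _).le

end GraphStar

-- Unicyclic graphs as trees with one added edge, and the comparison for coronas.

universe u

theorem TreeOn.map {V W : Type*} {G : SimpleGraph V} (f : W ↪ V) {S : Finset W}
    (hS : (G.comap f).TreeOn S) : G.TreeOn (S.map f) := by
  induction hS with
  | single v => rw [Finset.map_singleton]; exact .single _
  | @leaf S u y hS hu hy h ih =>
    rw [Finset.map_insert]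
    refine .leaf ih (Finset.mem_map_of_mem f hu) (by simpa using hy) fun z hz => ?_
    obtain ⟨w, hw, rfl⟩ := Finset.mem_map.1 hz
    rw [f.injective.eq_iff, ← h w hw, comap_adj]

theorem IsTree.treeOn_univ {V : Type u} [Fintype V] {T : SimpleGraph V} (hT : T.IsTree) :
    T.TreeOn Finset.univ := by
  obtain ⟨n, hn⟩ : ∃ n, Fintype.card V = n := ⟨_, rfl⟩
  induction n using Nat.strong_induction_on generalizing V with
  | _ n ih =>
    subst hn
    obtain ⟨v⟩ := hT.connected.nonempty
    rcases subsingleton_or_nontrivial V with hV | hV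
    · rw [show (Finset.univ : Finset V) = {v} from by ext; simp [hV.elim _ v]]
      exact .single v
    obtain ⟨v, hv⟩ := hT.exists_vert_degree_one_of_nontrivial
    have hc := hT.connected.induce_compl_singleton_of_degree_eq_one hv
    have h1 := ih (Fintype.card ({v}ᶜ : Set V)) (by
      rw [Fintype.card_compl_set]
      have := Fintype.card_pos (α := V)
      simp; omega) (T := T.induce {v}ᶜ) ⟨hc, hT.isAcyclic.induce _⟩ rfl
    have h2 := TreeOn.map (G := T) (Function.Embedding.subtype _) h1
    obtain ⟨w, hw, hw'⟩ := degree_eq_one_iff_existsUnique_adj.1 hv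
    have h3 := h2.leaf (u := w) (y := v) (by simpa using hw.ne.symm) (by simp) fun z hz =>
      ⟨fun h => hw' z h, fun h => h ▸ hw⟩
    convert h3
    ext z
    simp [em]

section Unicyclic

variable {V : Type*} {G : SimpleGraph V}

/-- A connected unicyclic graph arises from a tree by adding an edge. -/
theorem IsUnicyclic.exists_isTree (huni : G.IsUnicyclic) (hconn : G.Connected) :
    ∃ u v, G.Adj u v ∧ (G.deleteEdges {s(u, v)}).IsTree := by
  obtain ⟨C, ⟨w, p, hp, rfl⟩, hC⟩ := huni
  obtain ⟨e, he⟩ : ∃ e, e ∈ p.edges := by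
    have := hp.three_le_length
    rw [← Walk.length_edges] at this
    exact List.exists_mem_of_length_pos (by omega)
  induction e with
  | _ u v =>
    have hadj : G.Adj u v := p.adj_of_mem_edges he
    -- An edge of a cycle is not a bridge. A cycle avoiding it would be a second cycle of `G`.
    refine ⟨u, v, hadj, hconn.connected_delete_edge_of_not_isBridge fun h =>
      h.notMem_edges_of_isCycle hp he, fun z q hq => ?_⟩
    have hle := G.deleteEdges_le {s(u, v)}
    have h1 := hC _ ⟨z, q.mapLe hle, hq.mapLe hle, rfl⟩
    have h2 : s(u, v) ∈ (q.mapLe hle).edges := by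
      rw [← Walk.mem_edges_toSubgraph] at he ⊢
      rwa [h1]
    rw [Walk.edges_mapLe_eq_edges] at h2
    have := q.edges_subset_edgeSet h2
    simp at this

variable [Fintype V]

theorem card_edgeFinset_deleteEdges_add_one {u v : V} (huv : G.Adj u v) :
    (G.deleteEdges {s(u, v)}).edgeFinset.card + 1 = G.edgeFinset.card := by
  have h1 : (G.deleteEdges {s(u, v)}).edgeFinset = G.edgeFinset.erase s(u, v) := by
    ext e; simp [and_comm]
  rw [h1]
  exact Finset.card_erase_add_one (mem_edgeFinset.2 (show s(u, v) ∈ G.edgeSet from huv))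

theorem card_edgeFinset_of_isTree {u v : V} (huv : G.Adj u v)
    (hT : (G.deleteEdges {s(u, v)}).IsTree) : G.edgeFinset.card = Fintype.card V := by
  rw [← card_edgeFinset_deleteEdges_add_one huv, ← hT.card_edgeFinset]

theorem Connected.exists_isTree_of_card (hconn : G.Connected)
    (hcard : G.edgeFinset.card = Fintype.card V) :
    ∃ u v, G.Adj u v ∧ (G.deleteEdges {s(u, v)}).IsTree := by
  have hnot : ¬ G.IsAcyclic := fun h => by
    have := (IsTree.mk hconn h).card_edgeFinset
    omega
  rw [isAcyclic_iff_forall_adj_isBridge] at hnot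
  push Not at hnot
  obtain ⟨u, v, huv, hb⟩ := hnot
  refine ⟨u, v, huv, isTree_iff_connected_and_card.2
    ⟨hconn.connected_delete_edge_of_not_isBridge hb, ?_⟩⟩
  rw [Nat.card_eq_fintype_card, ← edgeFinset_card, Nat.card_eq_fintype_card, ← hcard]
  exact card_edgeFinset_deleteEdges_add_one huv

/-- Split the tree at the first edge `ux` of its path from `u` to `v`, then restore `uv`. Since `ux`
survives the deletion of `uv`, the vertices `x` and `v` differ. -/
theorem exists_unicyclic_decomposition {u v : V} (huv : G.Adj u v)
    (hT : (G.deleteEdges {s(u, v)}).IsTree) : ∃ (A B : Finset V) (x : V), A ∪ B = Finset.univ ∧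
      Disjoint A B ∧ G.TreeOn A ∧ G.TreeOn B ∧ u ∈ A ∧ x ∈ B ∧ v ∈ B ∧ x ≠ v ∧
      ∀ a ∈ A, ∀ b ∈ B, G.Adj a b ↔ a = u ∧ (b = x ∨ b = v) := by
  obtain ⟨A, B, x, hAB, hd, hA, hB, hu, hv, hx, hab⟩ :=
    hT.treeOn_univ.split (Finset.mem_univ u) (Finset.mem_univ v) huv.ne
  have hd' := Finset.disjoint_left.1 hd
  have hadj : ∀ a b, (G.deleteEdges {s(u, v)}).Adj a b ↔
      G.Adj a b ∧ ¬ (a = u ∧ b = v ∨ a = v ∧ b = u) := fun a b => by simp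
  refine ⟨A, B, x, hAB, hd, hA.congr fun a ha b hb => ?_, hB.congr fun a ha b hb => ?_, hu, hx, hv,
    ?_, fun a ha b hb => ?_⟩
  · rw [hadj, and_iff_left]
    rintro (⟨rfl, rfl⟩ | ⟨rfl, rfl⟩)
    · exact hd' hb hv
    · exact hd' ha hv
  · rw [hadj, and_iff_left]
    rintro (⟨rfl, rfl⟩ | ⟨rfl, rfl⟩)
    · exact hd' hu ha
    · exact hd' hu hb
  · rintro rfl
    have := (hab u hu x hx).2 ⟨rfl, rfl⟩
    simp at this
  · have h1 := hab a ha b hb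
    rw [hadj] at h1
    constructor
    · intro h
      by_cases h2 : a = u ∧ b = v ∨ a = v ∧ b = u
      · rcases h2 with ⟨rfl, rfl⟩ | ⟨rfl, rfl⟩
        · exact ⟨rfl, Or.inr rfl⟩
        · exact absurd hv (hd' ha)
      · obtain ⟨rfl, rfl⟩ := h1.1 ⟨h, h2⟩
        exact ⟨rfl, Or.inl rfl⟩
    · rintro ⟨rfl, rfl | rfl⟩
      · exact (h1.2 ⟨rfl, rfl⟩).1
      · exact huv

/-- Among the connected unicyclic graphs the values at `-s` are largest for the cycle and smallest
for the triangle with pendant vertices at one vertex. -/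
theorem unicyclic_bounds {s : ℝ} (hs : 0 ≤ s) (hpos : ∀ S, 0 < G.indepSum (-s) S)
    {u v : V} (huv : G.Adj u v) (hT : (G.deleteEdges {s(u, v)}).IsTree) {n : ℕ} (hn : 3 ≤ n)
    (hcard : Fintype.card V = n) :
    (triangleStar n).indepSum (-s) Finset.univ ≤ G.indepSum (-s) Finset.univ ∧
      G.indepSum (-s) Finset.univ ≤ (cycleGraph n).indepSum (-s) Finset.univ := by
  obtain ⟨A, B, x, hAB, hd, hA, hB, hu, hx, hv, hxv, h⟩ := exists_unicyclic_decomposition huv hT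
  obtain ⟨m, rfl⟩ := Nat.exists_eq_add_of_le' hn
  have hm : (A ∪ B).card = m + 3 := by rw [hAB, Finset.card_univ, hcard]
  have hs1 : s ≤ 1 := by
    have := hpos {u}
    rw [indepSum_singleton] at this
    linarith
  have h1 := unicyclic_le hs hpos hd hA hB hu hx hv hxv h hm
  have h2 := le_unicyclic hs hs1 hpos hd hB hu hx hv hxv hA h hm
  rw [hAB] at h1 h2
  rw [indepSum_triangleStar, indepSum_cycleGraph]
  refine ⟨le_trans (le_of_eq ?_) h2, h1⟩
  ring

theorem xi_eq_of_indepPoly_eq {W : Type*} [Fintype W] {H : SimpleGraph W}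
    (h : G.indepPoly = H.indepPoly) : G.xi = H.xi := by
  have : G.IsSmallestRoot = H.IsSmallestRoot := by
    funext r; unfold IsSmallestRoot; rw [h]
  unfold xi
  simp only [this]

theorem indepLE_of_xi_lt [Nonempty V] {W : Type*} [Fintype W] {H : SimpleGraph W}
    (h : ∀ x, G.xi < x → x ≤ 0 → G.indepPoly.eval x ≤ H.indepPoly.eval x) : H.IndepLE G :=
  fun _ hx => G.eval_le_eval_of_xi_le h hx

theorem xi_le_of_eval_le [Nonempty V] {W : Type*} [Fintype W] [Nonempty W] {H : SimpleGraph W}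
    (h : ∀ x, G.xi < x → x ≤ 0 → G.indepPoly.eval x ≤ H.indepPoly.eval x) : H.xi ≤ G.xi := by
  by_contra hlt
  have h1 := h H.xi (not_le.1 hlt) H.xi_neg.le
  rw [H.isSmallestRoot_xi.1] at h1
  exact absurd (G.eval_pos_of_xi_lt (not_le.1 hlt) H.xi_neg.le) (not_lt.2 h1)

theorem graphStar_bounds [Nonempty V] {ι : Type*} [Fintype ι] {H : SimpleGraph ι} {u v : ι}
    (huv : H.Adj u v) (hT : (H.deleteEdges {s(u, v)}).IsTree) {n : ℕ} (hn : 3 ≤ n)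
    (hcard : Fintype.card ι = n) (hG : G.indepPoly = H.graphStar.indepPoly) :
    ((cycleGraph n).graphStar.IndepLE G ∧ G.IndepLE (triangleStar n).graphStar) ∧
    ((cycleGraph n).graphStar.xi ≤ G.xi ∧ G.xi ≤ (triangleStar n).graphStar.xi) := by
  have : Nonempty ι := ⟨u⟩
  have : Nonempty (Fin n) := ⟨⟨0, by omega⟩⟩
  have hxi : G.xi = H.graphStar.xi := xi_eq_of_indepPoly_eq hG
  have key : ∀ x, G.xi < x → x ≤ 0 →
      (triangleStar n).graphStar.indepPoly.eval x ≤ G.indepPoly.eval x ∧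
        G.indepPoly.eval x ≤ (cycleGraph n).graphStar.indepPoly.eval x := by
    intro x hx hx0
    rw [hxi] at hx
    have h1 := neg_one_lt_of_xi_lt _ hx hx0
    have hpos := fun S => indepSum_pos_of_graphStar H hx hx0 S
    have hb := unicyclic_bounds (G := H) (s := -(x / (1 + x)))
      (neg_nonneg.2 (div_nonpos_of_nonpos_of_nonneg hx0 h1.le))
      (by rwa [neg_neg]) huv hT hn hcard
    rw [neg_neg] at hb
    rw [hG, eval_graphStar _ h1.ne', eval_graphStar _ h1.ne', eval_graphStar _ h1.ne', hcard,
      Fintype.card_fin]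
    exact ⟨mul_le_mul_of_nonneg_left hb.1 (pow_pos h1 n).le,
      mul_le_mul_of_nonneg_left hb.2 (pow_pos h1 n).le⟩
  -- Needed before the second relation: it places the interval starting at the root of the triangle
  -- star's corona inside the range covered by `key`.
  have hU : G.xi ≤ (triangleStar n).graphStar.xi := by
    refine le_xi_of_eval_nonpos _ G.xi_neg.le ?_
    have := G.eval_le_eval_of_xi_le (fun x hx hx0 => (key x hx hx0).1) ⟨le_rfl, G.xi_neg.le⟩
    rwa [show G.indepPoly.eval G.xi = 0 from G.isSmallestRoot_xi.1] at this
  exact ⟨⟨indepLE_of_xi_lt fun x hx hx0 => (key x hx hx0).2,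
    indepLE_of_xi_lt fun x hx hx0 => (key x (hU.trans_lt hx) hx0).1⟩,
    xi_le_of_eval_le fun x hx hx0 => (key x hx hx0).2, hU⟩

end Unicyclic

/-! ### A perfect matching from well-coveredness. -/

section WellCovered

variable {V : Type*} {G : SimpleGraph V}

theorem maximal_isIndepSet {s : Finset V} (hs : G.IsIndepSet (s : Set V))
    (h : ∀ a ∉ s, ∃ b ∈ s, G.Adj a b) : Maximal G.IsIndepSet (s : Set V) := by
  refine ⟨hs, fun t ht hst a ha => ?_⟩
  by_contra has
  obtain ⟨b, hb, hab⟩ := h a (by simpa using has)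
  exact ht ha (hst (by simpa using hb)) hab.ne hab

variable [Fintype V]

theorem IsIndepSet.exists_maximal {s : Finset V} (hs : G.IsIndepSet (s : Set V)) :
    ∃ t : Finset V, s ⊆ t ∧ Maximal G.IsIndepSet (t : Set V) := by
  obtain ⟨t, hst, ht⟩ := Finite.exists_le_maximal (p := G.IsIndepSet) hs
  exact ⟨t.toFinset, fun a ha => by simpa using hst (by simpa using ha), by simpa using ht⟩

theorem IsWellCovered.exists_card (h : G.IsWellCovered) : ∃ k,
    (∀ s : Finset V, Maximal G.IsIndepSet (s : Set V) → s.card = k) ∧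
      ∀ s : Finset V, G.IsIndepSet (s : Set V) → s.card ≤ k := by
  obtain ⟨t, -, ht⟩ := IsIndepSet.exists_maximal (G := G) (s := ∅) (by simp [isIndepSet_iff])
  refine ⟨t.card, fun s hs => h s t hs ht, fun s hs => ?_⟩
  obtain ⟨r, hsr, hr⟩ := hs.exists_maximal
  exact (Finset.card_le_card hsr).trans (h r t hr ht).le

theorem Connected.exists_adj (h : G.Connected) (hc : 1 < Fintype.card V) (a : V) :
    ∃ b, G.Adj a b := by
  have : Nontrivial V := Fintype.one_lt_card_iff_nontrivial.1 hc
  exact h.preconnected.exists_adj_of_nontrivial a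

variable {k : ℕ}

/-- Two leaves at the same vertex `v` could replace `v` in a maximal independent set, giving an
independent set of size `k + 1`. -/
theorem eq_of_forall_adj (hk : ∀ s : Finset V, Maximal G.IsIndepSet (s : Set V) → s.card = k)
    (hk' : ∀ s : Finset V, G.IsIndepSet (s : Set V) → s.card ≤ k) {v y z : V}
    (hy : ∀ b, G.Adj y b ↔ b = v) (hz : ∀ b, G.Adj z b ↔ b = v) : y = z := by
  by_contra hne
  obtain ⟨M, hvM, hM⟩ := IsIndepSet.exists_maximal (G := G) (s := {v}) (by simp [isIndepSet_iff])
  have hvM : v ∈ M := hvM (by simp)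
  have hM1 := hM.1
  have hyM : y ∉ M := fun h => hM1 h hvM ((hy v).2 rfl).ne ((hy v).2 rfl)
  have hzM : z ∉ M := fun h => hM1 h hvM ((hz v).2 rfl).ne ((hz v).2 rfl)
  have h1 := hk' (insert y (insert z (M.erase v))) (by
    rw [isIndepSet_iff, Finset.coe_insert, Finset.coe_insert]
    refine Set.Pairwise.insert (Set.Pairwise.insert (hM1.mono (by simp)) fun b hb _ => ?_)
      fun b hb hyb => ?_
    · have : b ≠ v := by rintro rfl; simp at hb
      exact ⟨fun h => this ((hz b).1 h), fun h => this ((hz b).1 h.symm)⟩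
    · have : b ≠ v := by
        rintro rfl
        rcases hb with h | h
        · exact ((hz b).2 rfl).ne h.symm
        · simp at h
      exact ⟨fun h => this ((hy b).1 h), fun h => this ((hy b).1 h.symm)⟩)
  rw [Finset.card_insert_of_notMem (by simp [hne, hyM]),
    Finset.card_insert_of_notMem (by simp [hzM]), Finset.card_erase_of_mem hvM] at h1
  have := hk M hM
  have := Finset.card_pos.2 ⟨v, hvM⟩
  omega

/-- A perfect matching between the two parts `X` and `Xᶜ`, by Hall's theorem. -/
theorem exists_equiv_of_hall {X : Finset V} {n : ℕ} (hX : X.card = n)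
    (hV : Fintype.card V = 2 * n)
    (h : ∀ S ⊆ X, S.card ≤ (Xᶜ.filter fun y => ∃ a ∈ S, G.Adj a y).card) :
    ∃ e : X ⊕ X ≃ V, ∀ i, G.Adj (e (.inl i)) (e (.inr i)) := by
  obtain ⟨f, hf, hf'⟩ := (Finset.all_card_le_biUnion_card_iff_exists_injective
    (fun a : X => Xᶜ.filter fun y => G.Adj a y)).1 fun s => by
      have := h (s.map (Function.Embedding.subtype _)) fun a ha => by
        obtain ⟨b, -, rfl⟩ := Finset.mem_map.1 ha
        exact b.2
      rw [Finset.card_map] at this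
      refine this.trans (Finset.card_le_card fun y hy => ?_)
      obtain ⟨hy, a, ha, hay⟩ := Finset.mem_filter.1 hy
      obtain ⟨b, hb, rfl⟩ := Finset.mem_map.1 ha
      exact Finset.mem_biUnion.2 ⟨b, hb, Finset.mem_filter.2 ⟨hy, hay⟩⟩
  have hbij : Function.Bijective (Sum.elim (fun a : X => (a : V)) f) := by
    rw [Fintype.bijective_iff_injective_and_card]
    constructor
    · refine Function.Injective.sumElim Subtype.val_injective hf fun a b hab => ?_
      have := (Finset.mem_filter.1 (hf' b)).1
      rw [← hab] at this
      exact Finset.mem_compl.1 this a.2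
    · rw [Fintype.card_sum, Fintype.card_coe, hX, hV]; ring
  exact ⟨Equiv.ofBijective _ hbij, fun i => (Finset.mem_filter.1 (hf' i)).2⟩

/-- The independent sets obtained from `Y` by exchange give the condition in Hall's theorem. -/
theorem card_le_of_exchange (hk' : ∀ s : Finset V, G.IsIndepSet (s : Set V) → s.card ≤ k)
    {X S : Finset V} (hY : G.IsIndepSet (Xᶜ : Finset V)) (hYk : Xᶜ.card = k) (hSX : S ⊆ X)
    (hS : G.IsIndepSet (S : Set V)) :
    S.card ≤ (Xᶜ.filter fun y => ∃ a ∈ S, G.Adj a y).card := by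
  have hd : Disjoint S (Xᶜ.filter fun y => ¬ ∃ a ∈ S, G.Adj a y) :=
    (disjoint_compl_right (a := X)).mono hSX (Finset.filter_subset _ _)
  -- Exchange: `S` replaces its neighbours in `Xᶜ`. The result is independent, so it has at most `k`
  -- elements.
  have h1 := hk' (S ∪ Xᶜ.filter fun y => ¬ ∃ a ∈ S, G.Adj a y) (by
    intro a ha b hb hab hadj
    simp only [Finset.coe_union, Set.mem_union, Finset.mem_coe, Finset.mem_filter] at ha hb
    rcases ha with ha | ⟨ha, ha'⟩ <;> rcases hb with hb | ⟨hb, hb'⟩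
    · exact hS ha hb hab hadj
    · exact hb' ⟨a, ha, hadj⟩
    · exact ha' ⟨b, hb, hadj.symm⟩
    · exact hY ha hb hab hadj)
  rw [Finset.card_union_of_disjoint hd] at h1
  have h2 := Finset.card_filter_add_card_filter_not (s := Xᶜ) fun y => ∃ a ∈ S, G.Adj a y
  omega

/-- A connected well-covered unicyclic graph of order `2n` has a perfect matching, and its maximal
independent sets have `n` vertices. -/
theorem exists_perfect_matching (hk : ∀ s : Finset V, Maximal G.IsIndepSet (s : Set V) → s.card = k)
    (hk' : ∀ s : Finset V, G.IsIndepSet (s : Set V) → s.card ≤ k) {u v : V} (huv : G.Adj u v)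
    (hT : (G.deleteEdges {s(u, v)}).IsTree) {n : ℕ} (hn : 2 ≤ n) (hV : Fintype.card V = 2 * n) :
    k = n ∧ ∃ (X : Finset V) (e : X ⊕ X ≃ V), ∀ i, G.Adj (e (.inl i)) (e (.inr i)) := by
  obtain ⟨c⟩ := hT.colorable_two
  have hadj : ∀ {a b}, G.Adj a b → c a ≠ c b ∨ (a = u ∧ b = v) ∨ (a = v ∧ b = u) := by
    intro a b hab
    by_cases h : (G.deleteEdges {s(u, v)}).Adj a b
    · exact Or.inl (c.valid h)
    · right
      simp [hab] at h
      tauto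
  have htwo : ∀ {a b w : Fin 2}, a ≠ w → b ≠ w → a = b := by omega
  have hTadj := hT.connected.exists_adj (by omega)
  set X := Finset.univ.filter fun a => c a = c u with hXdef
  have hXm : ∀ a, a ∈ X ↔ c a = c u := by simp [hXdef]
  have hcard : X.card + Xᶜ.card = 2 * n := by rw [Finset.card_add_card_compl, hV]
  have hY : G.IsIndepSet (Xᶜ : Finset V) := by
    intro a ha b hb hab h
    simp only [Finset.coe_compl, Set.mem_compl_iff, Finset.mem_coe, hXm] at ha hb
    rcases hadj h with h | ⟨rfl, rfl⟩ | ⟨rfl, rfl⟩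
    · exact h (htwo ha hb)
    · exact ha rfl
    · exact hb rfl
  have hYk : Xᶜ.card = k := by
    refine hk _ (maximal_isIndepSet hY fun a ha => ?_)
    rw [Finset.mem_compl, not_not, hXm] at ha
    obtain ⟨b, hb⟩ := hTadj a
    refine ⟨b, ?_, (deleteEdges_le _) hb⟩
    rw [Finset.mem_compl, hXm, ← ha]
    exact (c.valid hb).symm
  -- `Xᶜ` is a maximal independent set in both cases. If the cycle is odd, `uv` lies inside `X`, and
  -- only `X` without one end is independent; if it is even, `X` is independent too.
  by_cases hcuv : c u = c v
  · have huX : u ∈ X := (hXm u).2 rfl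
    have hvX : v ∈ X := (hXm v).2 hcuv.symm
    have hindep : ∀ S ⊆ X, (u ∉ S ∨ v ∉ S) → G.IsIndepSet (S : Set V) := by
      intro S hS huvS a ha b hb _ h
      rcases hadj h with h | ⟨rfl, rfl⟩ | ⟨rfl, rfl⟩
      · exact h (((hXm a).1 (hS ha)).trans ((hXm b).1 (hS hb)).symm)
      · exact huvS.elim (fun h => h ha) fun h => h hb
      · exact huvS.elim (fun h => h hb) fun h => h ha
    have hI := hindep (X.erase v) (Finset.erase_subset v X) (Or.inr (by simp))
    have hleq := hk' _ hI
    rw [Finset.card_erase_of_mem hvX] at hleq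
    obtain ⟨M, hXM, hM⟩ := hI.exists_maximal
    have hvM : v ∉ M := fun h =>
      hM.1 (hXM (Finset.mem_erase.2 ⟨huv.ne, huX⟩)) h huv.ne huv
    have hleaf : ∀ y ∈ M \ X.erase v, y ∈ Xᶜ ∧ ∀ b, G.Adj y b ↔ b = v := by
      intro y hy
      obtain ⟨hyM, hyX⟩ := Finset.mem_sdiff.1 hy
      have hyv : y ≠ v := by rintro rfl; exact hvM hyM
      have hyX : y ∉ X := fun h => hyX (Finset.mem_erase.2 ⟨hyv, h⟩)
      have h1 : ∀ b, G.Adj y b → b = v := by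
        intro b hb
        by_contra hbv
        have hbX : b ∈ X := by
          by_contra h
          exact hY (by simpa using hyX) (by simpa using h) hb.ne hb
        exact hM.1 hyM (hXM (Finset.mem_erase.2 ⟨hbv, hbX⟩)) hb.ne hb
      refine ⟨Finset.mem_compl.2 hyX, fun b => ⟨h1 b, ?_⟩⟩
      rintro rfl
      obtain ⟨z, hz⟩ := hTadj y
      have hz := (deleteEdges_le _) hz
      rwa [← h1 z hz]
    have hone : (M \ X.erase v).card ≤ 1 := Finset.card_le_one.2 fun y hy z hz =>
      eq_of_forall_adj hk hk' (hleaf y hy).2 (hleaf z hz).2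
    have hMk := hk M hM
    have hsd := Finset.card_sdiff_add_card_eq_card hXM
    rw [Finset.card_erase_of_mem hvX] at hsd
    have hXpos := Finset.card_pos.2 ⟨v, hvX⟩
    -- `M` has `|X| - 1` or `|X|` elements, and `|X| = 2n - k`. Parity rules out the first, so `v`
    -- has exactly one leaf; it is the extra neighbour used for sets `S` containing `v`.
    obtain rfl : k = n := by omega
    refine ⟨rfl, X, exists_equiv_of_hall (by omega) hV fun S hS => ?_⟩
    by_cases hvS : v ∈ S
    · obtain ⟨y, hy⟩ := Finset.card_pos.1 (show 0 < (M \ X.erase v).card by omega)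
      obtain ⟨hyX, hyv⟩ := hleaf y hy
      have h1 := card_le_of_exchange hk' hY hYk ((Finset.erase_subset v S).trans hS)
        (hindep _ ((Finset.erase_subset v S).trans hS) (Or.inr (by simp)))
      have h2 : insert y (Xᶜ.filter fun y => ∃ a ∈ S.erase v, G.Adj a y) ⊆
          Xᶜ.filter fun y => ∃ a ∈ S, G.Adj a y := by
        intro z hz
        rcases Finset.mem_insert.1 hz with rfl | hz
        · exact Finset.mem_filter.2 ⟨hyX, v, hvS, ((hyv v).2 rfl).symm⟩
        · obtain ⟨hz, a, ha, haz⟩ := Finset.mem_filter.1 hz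
          exact Finset.mem_filter.2 ⟨hz, a, Finset.mem_of_mem_erase ha, haz⟩
      have h3 := Finset.card_le_card h2
      rw [Finset.card_insert_of_notMem] at h3
      · rw [Finset.card_erase_of_mem hvS] at h1
        omega
      · intro h
        obtain ⟨-, a, ha, hay⟩ := Finset.mem_filter.1 h
        exact Finset.ne_of_mem_erase ha ((hyv a).1 hay.symm)
    · exact card_le_of_exchange hk' hY hYk hS (hindep S hS (Or.inr hvS))
  · have hX : G.IsIndepSet (X : Set V) := by
      intro a ha b hb _ h
      have ha := (hXm a).1 (by simpa using ha)
      have hb := (hXm b).1 (by simpa using hb)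
      rcases hadj h with h | ⟨rfl, rfl⟩ | ⟨rfl, rfl⟩
      · exact h (ha.trans hb.symm)
      · exact hcuv hb.symm
      · exact hcuv ha.symm
    have hXk : X.card = k := by
      refine hk _ (maximal_isIndepSet hX fun a ha => ?_)
      rw [hXm] at ha
      obtain ⟨b, hb⟩ := hTadj a
      refine ⟨b, (hXm b).2 ?_, (deleteEdges_le _) hb⟩
      exact htwo (c.valid hb).symm (Ne.symm ha)
    obtain rfl : k = n := by omega
    exact ⟨rfl, X, exists_equiv_of_hall hXk hV fun S hS =>
      card_le_of_exchange hk' hY hYk hS (hX.mono (by simpa using hS))⟩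

end WellCovered

/-! ### Uniqueness of 4-cycles and edge counting. -/

section Cycles

variable {V : Type*} {G : SimpleGraph V}

theorem IsUnicyclic.four_cycle_eq (h : G.IsUnicyclic) {a b c d a' b' c' d' : V}
    (hab : G.Adj a b) (hbc : G.Adj b c) (hcd : G.Adj c d) (hda : G.Adj d a) (hac : a ≠ c)
    (hbd : b ≠ d) (hab' : G.Adj a' b') (hbc' : G.Adj b' c') (hcd' : G.Adj c' d')
    (hda' : G.Adj d' a') (hac' : a' ≠ c') (hbd' : b' ≠ d') {x : V}
    (hx : x = a ∨ x = b ∨ x = c ∨ x = d) : x = a' ∨ x = b' ∨ x = c' ∨ x = d' := by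
  have key : ∀ {a b c d : V} (hab : G.Adj a b) (hbc : G.Adj b c) (hcd : G.Adj c d)
      (hda : G.Adj d a), a ≠ c → b ≠ d →
      (Walk.cons hab (.cons hbc (.cons hcd (.cons hda .nil)))).IsCycle := by
    intro a b c d hab hbc hcd hda hac hbd
    have := hab.ne; have := hbc.ne; have := hcd.ne; have := hda.ne
    rw [Walk.cons_isCycle_iff]
    simp [Walk.isPath_def]
    grind
  obtain ⟨C, -, hC⟩ := h
  have h1 := hC _ ⟨_, _, key hab hbc hcd hda hac hbd, rfl⟩
  have h2 := hC _ ⟨_, _, key hab' hbc' hcd' hda' hac' hbd', rfl⟩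
  have h3 : x ∈ (Walk.cons hab (.cons hbc (.cons hcd (.cons hda .nil)))).toSubgraph.verts := by
    rw [Walk.mem_verts_toSubgraph]
    simp
    tauto
  rw [h1, ← h2, Walk.mem_verts_toSubgraph] at h3
  simp at h3
  tauto

theorem Connected.forall_of_closed (h : G.Connected) {p : V → Prop} {a : V} (ha : p a)
    (hp : ∀ b c, p b → G.Adj b c → p c) (b : V) : p b := by
  obtain ⟨w⟩ := h.preconnected a b
  induction w with
  | nil => exact ha
  | cons hadj _ ih => exact ih (hp _ _ ha hadj)

theorem card_filter_adj [Fintype V] :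
    (Finset.univ.filter fun p : V × V => G.Adj p.1 p.2).card = 2 * G.edgeFinset.card := by
  rw [← G.sum_degrees_eq_twice_card_edges, Finset.card_filter, ← Finset.univ_product_univ,
    Finset.sum_product]
  refine Finset.sum_congr rfl fun v _ => ?_
  rw [← card_neighborFinset_eq_degree, neighborFinset_eq_filter, Finset.card_filter]

end Cycles

/-! ### Tight matchings and their contraction. -/

section Matching

variable {V ι : Type*} {G : SimpleGraph V}

/-- The index of the matching edge that contains a vertex. -/
def matchIndex (e : ι ⊕ ι ≃ V) (a : V) : ι := Sum.elim id id (e.symm a)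

@[simp] theorem matchIndex_apply (e : ι ⊕ ι ≃ V) (x : ι ⊕ ι) :
    matchIndex e (e x) = Sum.elim id id x := by simp [matchIndex]

theorem matchIndex_eq_iff (e : ι ⊕ ι ≃ V) {a : V} {i : ι} :
    matchIndex e a = i ↔ a = e (.inl i) ∨ a = e (.inr i) := by
  obtain ⟨x | x, rfl⟩ := e.surjective a <;> simp

/-- The graph obtained from `G` by contracting the edges of a perfect matching. -/
def matchQuotient (G : SimpleGraph V) (e : ι ⊕ ι ≃ V) : SimpleGraph ι where
  Adj i j := i ≠ j ∧ ∃ a b, G.Adj a b ∧ matchIndex e a = i ∧ matchIndex e b = j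
  symm := ⟨fun _ _ ⟨hne, a, b, h, ha, hb⟩ => ⟨hne.symm, b, a, h.symm, hb, ha⟩⟩
  loopless := ⟨fun _ h => h.1 rfl⟩

theorem matchQuotient_connected (e : ι ⊕ ι ≃ V) (h : G.Connected) :
    (G.matchQuotient e).Connected := by
  obtain ⟨a⟩ := h.nonempty
  refine (connected_iff_exists_forall_reachable _).2 ⟨matchIndex e a, fun i => ?_⟩
  have := h.forall_of_closed (p := fun b => (G.matchQuotient e).Reachable (matchIndex e a)
    (matchIndex e b)) (a := a) (Reachable.refl _) (fun b c hb hbc => ?_) (e (.inl i))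
  · simpa using this
  · by_cases hne : matchIndex e b = matchIndex e c
    · rwa [← hne]
    · exact hb.trans (Adj.reachable ⟨hne, b, c, hbc, rfl, rfl⟩)

theorem matchIndex_eq_matchIndex_iff (e : ι ⊕ ι ≃ V) {x y : ι ⊕ ι} :
    matchIndex e (e x) = matchIndex e (e y) ↔ y = x ∨ y = x.swap := by
  rw [matchIndex_apply, matchIndex_apply]
  rcases x with x | x <;> rcases y with y | y <;> simp [eq_comm]

/-- Both ends of the matching edge at `x` have further neighbours. -/
def IsInnerEdge (G : SimpleGraph V) (e : ι ⊕ ι ≃ V) (x : ι ⊕ ι) : Prop :=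
  (∃ y, G.Adj (e x) y ∧ y ≠ e x.swap) ∧ ∃ y, G.Adj (e x.swap) y ∧ y ≠ e x

/-- Every maximal independent set contains an end of every edge of the perfect matching `e`. -/
structure IsTightMatching (G : SimpleGraph V) (e : ι ⊕ ι ≃ V) : Prop where
  adj : ∀ x, G.Adj (e x) (e x.swap)
  adj_of_adj : ∀ {x y z}, G.Adj (e x) y → y ≠ e x.swap → G.Adj (e x.swap) z → z ≠ e x → G.Adj y z

/-- An independent set contains at most one end of each matching edge. If `y` and `z` were not
adjacent, a maximal one containing both would miss both ends of the edge at `x` and be too small. -/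
theorem isTightMatching_of_card [Fintype V] [Fintype ι] {e : ι ⊕ ι ≃ V}
    (he : ∀ x, G.Adj (e x) (e x.swap))
    (hk : ∀ s : Finset V, Maximal G.IsIndepSet (s : Set V) → s.card = Fintype.card ι) :
    G.IsTightMatching e := by
  refine ⟨he, fun {x y z} hxy hy hxz hz => ?_⟩
  by_contra hyz
  obtain ⟨M, hM, hmax⟩ := IsIndepSet.exists_maximal (G := G) (s := {y, z}) (by
    intro a ha b hb hab h
    simp only [Finset.coe_insert, Finset.coe_singleton, Set.mem_insert_iff,
      Set.mem_singleton_iff] at ha hb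
    rcases ha with rfl | rfl <;> rcases hb with rfl | rfl
    · exact hab rfl
    · exact hyz h
    · exact hyz h.symm
    · exact hab rfl)
  have hyM : y ∈ M := hM (by simp)
  have hzM : z ∈ M := hM (by simp)
  have hx1 : e x ∉ M := fun h => hmax.1 h hyM hxy.ne hxy
  have hx2 : e x.swap ∉ M := fun h => hmax.1 h hzM hxz.ne hxz
  have hle : M.card ≤ (Finset.univ.erase (matchIndex e (e x))).card := by
    refine Finset.card_le_card_of_injOn (matchIndex e) (fun a ha => ?_) fun a ha b hb hab => ?_
    · obtain ⟨w, rfl⟩ := e.surjective a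
      simp only [Finset.coe_erase, Finset.coe_univ, Set.mem_sdiff, Set.mem_univ, true_and,
        Set.mem_singleton_iff]
      intro h
      rcases (matchIndex_eq_matchIndex_iff e).1 h.symm with rfl | rfl
      · exact hx1 ha
      · exact hx2 ha
    · obtain ⟨w, rfl⟩ := e.surjective a
      obtain ⟨w', rfl⟩ := e.surjective b
      rcases (matchIndex_eq_matchIndex_iff e).1 hab with rfl | rfl
      · rfl
      · exact absurd (he w) (hmax.1 ha hb (he w).ne)
  rw [hk M hmax, Finset.card_erase_of_mem (Finset.mem_univ _), Finset.card_univ] at hle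
  have := Fintype.card_pos_iff.2 ⟨matchIndex e (e x)⟩
  omega

namespace IsTightMatching

variable {e : ι ⊕ ι ≃ V} (he : G.IsTightMatching e) (huni : G.IsUnicyclic)

include he huni

/-- The ends of an inner edge have degree 2: tightness makes a third neighbour `w` adjacent to `z`,
closing a second 4-cycle. -/
theorem eq_of_adj {x : ι ⊕ ι} {y z w : V} (hxy : G.Adj (e x) y) (hy : y ≠ e x.swap)
    (hxz : G.Adj (e x.swap) z) (hz : z ≠ e x) (hw : G.Adj (e x) w) : w = e x.swap ∨ w = y := by
  by_contra! h
  have h1 := he.adj_of_adj hxy hy hxz hz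
  have h2 := he.adj_of_adj hw h.1 hxz hz
  rcases huni.four_cycle_eq (he.adj x) hxz h2.symm hw.symm hz.symm h.1.symm (he.adj x) hxz h1.symm
    hxy.symm hz.symm hy.symm (x := w) (by simp) with rfl | rfl | rfl | rfl
  · exact hw.ne rfl
  · exact h.1 rfl
  · exact h2.ne rfl
  · exact h.2 rfl

/-- Two inner edges would lie on the same 4-cycle as opposite edges. All four of its vertices would
have degree 2, so connectedness would leave only four vertices. -/
theorem inner_unique [Fintype V] (hconn : G.Connected) (hV : 4 < Fintype.card V) {x w : ι ⊕ ι}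
    (hx : G.IsInnerEdge e x) (hw : G.IsInnerEdge e w) :
    matchIndex e (e x) = matchIndex e (e w) := by
  by_contra hne
  obtain ⟨⟨y, hxy, hy⟩, z, hxz, hz⟩ := hx
  obtain ⟨⟨y', hwy, hy'⟩, z', hwz, hz'⟩ := hw
  have h1 := he.adj_of_adj hxy hy hxz hz
  have h2 := he.adj_of_adj hwy hy' hwz hz'
  have hne1 : e w ≠ e x := fun h => hne (by rw [h])
  have hne2 : e w ≠ e x.swap := fun h => hne
    ((matchIndex_eq_matchIndex_iff e).2 (Or.inr (e.injective h)))
  have hne3 : e w.swap ≠ e x := fun h => hne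
    ((matchIndex_eq_matchIndex_iff e).2 (Or.inr (by rw [← e.injective h, Sum.swap_swap])))
  have hne4 : e w.swap ≠ e x.swap := fun h => hne
    (by rw [← Sum.swap_swap x, ← e.injective h, Sum.swap_swap])
  have hcyc : ∀ a, (a = e w ∨ a = e w.swap ∨ a = z' ∨ a = y') →
      (a = e x ∨ a = e x.swap ∨ a = z ∨ a = y) := fun a => huni.four_cycle_eq (he.adj w) hwz
    h2.symm hwy.symm hz'.symm hy'.symm (he.adj x) hxz h1.symm hxy.symm hz.symm hy.symm
  have key : ∀ v, e v = y → e v.swap = z → False := by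
    rintro v rfl rfl
    have hall := hconn.forall_of_closed
      (p := fun a => a ∈ ({e x, e x.swap, e v, e v.swap} : Finset V)) (a := e x) (by simp) ?_
    · have := Finset.card_le_card (fun a _ => hall a : Finset.univ ⊆ _)
      have := this.trans Finset.card_le_four
      rw [Finset.card_univ] at this
      omega
    · intro a b ha hab
      simp only [Finset.mem_insert, Finset.mem_singleton] at ha ⊢
      rcases ha with rfl | rfl | rfl | rfl
      · have := he.eq_of_adj huni hxy hy hxz hz hab
        tauto
      · have := he.eq_of_adj huni (x := x.swap) hxz (by simpa using hz) (by simpa using hxy) hy hab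
        rw [Sum.swap_swap] at this
        tauto
      · have := he.eq_of_adj huni hxy.symm hz.symm hxz.symm hy.symm hab
        tauto
      · have := he.eq_of_adj huni (x := v.swap) hxz.symm (by simpa using hy.symm)
          (by simpa using hxy.symm) hz.symm hab
        rw [Sum.swap_swap] at this
        tauto
  rcases hcyc (e w) (by simp) with h | h | h | h
  · exact hne1 h
  · exact hne2 h
  · rcases hcyc (e w.swap) (by simp) with h' | h' | h' | h'
    · exact hne3 h'
    · exact hne4 h'
    · exact (he.adj w).ne (h.trans h'.symm)
    · exact key w.swap h' (by rwa [Sum.swap_swap])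
  · rcases hcyc (e w.swap) (by simp) with h' | h' | h' | h'
    · exact hne3 h'
    · exact hne4 h'
    · exact key w h h'
    · exact (he.adj w).ne (h.trans h'.symm)

/-- Contraction merges no two nonmatching edges. Two that share an end would form a triangle with a
matching edge, against tightness; two disjoint ones would make both matching edges inner. -/
theorem cross_unique [Fintype V] (hconn : G.Connected) (hV : 4 < Fintype.card V)
    {a b a' b' : V} (hab : G.Adj a b) (hab' : G.Adj a' b')
    (ha : matchIndex e a = matchIndex e a') (hb : matchIndex e b = matchIndex e b')
    (hne : matchIndex e a ≠ matchIndex e b) : a = a' ∧ b = b' := by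
  obtain ⟨x, rfl⟩ := e.surjective a
  obtain ⟨x', rfl⟩ := e.surjective a'
  obtain ⟨y, rfl⟩ := e.surjective b
  obtain ⟨y', rfl⟩ := e.surjective b'
  have n1 : e y ≠ e x.swap := fun h => hne
    ((matchIndex_eq_matchIndex_iff e).2 (Or.inr (e.injective h)))
  have n2 : e y ≠ e x := fun h => hne (by rw [h])
  have n3 : e y.swap ≠ e x := fun h => hne
    ((matchIndex_eq_matchIndex_iff e).2 (Or.inr (by rw [← e.injective h, Sum.swap_swap])))
  rcases (matchIndex_eq_matchIndex_iff e).1 ha with rfl | rfl <;>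
    rcases (matchIndex_eq_matchIndex_iff e).1 hb with rfl | rfl
  · exact ⟨rfl, rfl⟩
  · exact absurd rfl (he.adj_of_adj hab.symm n3.symm hab'.symm n2.symm).ne
  · exact absurd rfl (he.adj_of_adj hab n1 hab' n2).ne
  · refine absurd (he.inner_unique huni hconn hV (x := x) (w := y) ⟨⟨_, hab, n1⟩, _, hab', n3⟩
      ⟨⟨_, hab.symm, n3.symm⟩, _, hab'.symm, n1.symm⟩) hne

theorem card_edgeFinset_matchQuotient [Fintype V] [Fintype ι] (hconn : G.Connected)
    (hV : 4 < Fintype.card V) (hE : G.edgeFinset.card = Fintype.card V) :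
    (G.matchQuotient e).edgeFinset.card = Fintype.card ι := by
  have h1 := card_filter_adj (G := G)
  have h2 := card_filter_adj (G := G.matchQuotient e)
  have hVι : Fintype.card V = Fintype.card ι + Fintype.card ι := by
    rw [← Fintype.card_congr e, Fintype.card_sum]
  have h3 := Finset.card_filter_add_card_filter_not
    (s := Finset.univ.filter fun p : V × V => G.Adj p.1 p.2)
    (fun p => matchIndex e p.1 = matchIndex e p.2)
  have h4 : ((Finset.univ.filter fun p : V × V => G.Adj p.1 p.2).filter
      fun p => matchIndex e p.1 = matchIndex e p.2).card = Fintype.card V := by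
    rw [← Fintype.card_congr e, ← Finset.card_univ]
    symm
    refine Finset.card_nbij (fun x => (e x, e x.swap)) (fun x _ => ?_) (fun x _ y _ h => ?_) ?_
    · simp [he.adj x, -matchIndex_apply, matchIndex_eq_matchIndex_iff]
    · exact e.injective (Prod.ext_iff.1 h).1
    · rintro ⟨a, b⟩ h
      obtain ⟨x, rfl⟩ := e.surjective a
      obtain ⟨y, rfl⟩ := e.surjective b
      simp only [Finset.coe_filter, Finset.mem_filter, Finset.mem_univ, true_and,
        Set.mem_ofPred_eq, matchIndex_eq_matchIndex_iff] at h
      obtain ⟨h, rfl | rfl⟩ := h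
      · exact absurd rfl h.ne
      · exact ⟨x, by simp, rfl⟩
  have h5 : ((Finset.univ.filter fun p : V × V => G.Adj p.1 p.2).filter
      fun p => ¬ matchIndex e p.1 = matchIndex e p.2).card =
      (Finset.univ.filter fun p : ι × ι => (G.matchQuotient e).Adj p.1 p.2).card := by
    refine Finset.card_nbij (fun p => (matchIndex e p.1, matchIndex e p.2)) ?_ ?_ ?_
    · rintro ⟨a, b⟩ h
      simp only [Finset.coe_filter, Finset.mem_filter, Finset.mem_univ, true_and,
        Set.mem_ofPred_eq] at h ⊢
      exact ⟨h.2, a, b, h.1, rfl, rfl⟩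
    · rintro ⟨a, b⟩ h ⟨a', b'⟩ h' heq
      simp only [Finset.coe_filter, Finset.mem_filter, Finset.mem_univ, true_and,
        Set.mem_ofPred_eq, Prod.mk.injEq] at h h' heq
      obtain ⟨rfl, rfl⟩ := he.cross_unique huni hconn hV h.1 h'.1 heq.1 heq.2 h.2
      rfl
    · rintro ⟨i, j⟩ h
      simp only [Finset.coe_filter, Finset.mem_univ, true_and, Set.mem_ofPred_eq] at h
      obtain ⟨hij, a, b, hab, rfl, rfl⟩ := h
      exact ⟨(a, b), by simp [hab, hij], rfl⟩
  -- Of the `2|V|` ordered adjacent pairs, `|V|` come from the matching; the other `|V| = 2|ι|`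
  -- correspond to those of the quotient.
  omega

end IsTightMatching

end Matching

/-! ### Recovering the independence polynomial of a corona. -/

section Corona

variable {V ι : Type*} {G : SimpleGraph V}

/-- Swapping the ends of some matching edges places a leaf on the right whenever an edge has one, as
in a corona. -/
theorem exists_leaf_right {e : ι ⊕ ι ≃ V} : ∃ e' : ι ⊕ ι ≃ V,
    (∀ x, e' x = e x ∧ e' x.swap = e x.swap ∨ e' x = e x.swap ∧ e' x.swap = e x) ∧
      ∀ i, (∀ b, G.Adj (e' (.inr i)) b → b = e' (.inl i)) ∨ G.IsInnerEdge e' (.inl i) := by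
  set p : ι → Prop := fun i => ∀ b, G.Adj (e (.inr i)) b → b = e (.inl i)
  set g : ι ⊕ ι → ι ⊕ ι := fun x => if p (Sum.elim id id x) then x else x.swap
  have hg : Function.Involutive g := by
    rintro (i | i) <;> by_cases h : p i <;> simp [g, h]
  have h1 : ∀ i, p i → g (.inl i) = .inl i ∧ g (.inr i) = .inr i := fun i h => by simp [g, h]
  have h2 : ∀ i, ¬ p i → g (.inl i) = .inr i ∧ g (.inr i) = .inl i := fun i h => by simp [g, h]
  refine ⟨hg.toPerm.trans e, ?_, fun i => ?_⟩
  · rintro (i | i) <;> by_cases h : p i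
    · left; simp [h1 i h]
    · right; simp [h2 i h]
    · left; simp [h1 i h]
    · right; simp [h2 i h]
  · by_cases h : p i
    · left
      simpa [h1 i h] using h
    · by_cases h' : ∀ b, G.Adj (e (.inl i)) b → b = e (.inr i)
      · left
        simpa [h2 i h] using h'
      · right
        simp only [p] at h
        push Not at h h'
        have := h2 i (by simpa [p] using h)
        simp only [IsInnerEdge, Equiv.trans_apply, Function.Involutive.coe_toPerm, Sum.swap_inl,
          this.1, this.2]
        exact ⟨h, h'⟩

theorem graphStar_matchQuotient_adj {e : ι ⊕ ι ≃ V} (he : ∀ x, G.Adj (e x) (e x.swap))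
    {x y : ι ⊕ ι}
    (hx : ∀ b, G.Adj (e (.inr (Sum.elim id id x))) b → b = e (.inl (Sum.elim id id x)))
    (hy : ∀ b, G.Adj (e (.inr (Sum.elim id id y))) b → b = e (.inl (Sum.elim id id y))) :
    (G.comap e).Adj x y ↔ (G.matchQuotient e).graphStar.Adj x y := by
  rw [comap_adj]
  rcases x with i | i <;> rcases y with j | j <;> simp only [Sum.elim_inl, Sum.elim_inr, id] at hx hy
  · constructor
    · intro h
      refine ⟨?_, _, _, h, by simp, by simp⟩
      rintro rfl
      exact h.ne rfl
    · rintro ⟨hne, a, b, hab, ha, hb⟩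
      rcases (matchIndex_eq_iff e).1 ha with rfl | rfl
      · rcases (matchIndex_eq_iff e).1 hb with rfl | rfl
        · exact hab
        · exact absurd (Sum.inl_injective (e.injective (hy _ hab.symm))) hne
      · have := hx _ hab
        subst this
        rw [matchIndex_apply] at hb
        exact absurd hb hne
  · change _ ↔ i = j
    constructor
    · intro h
      exact Sum.inl_injective (e.injective (hy _ h.symm))
    · rintro rfl
      exact he (.inl i)
  · change _ ↔ i = j
    constructor
    · intro h
      exact (Sum.inl_injective (e.injective (hx _ h))).symm
    · rintro rfl
      exact he (.inr i)
  · refine iff_of_false (fun h => ?_) id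
    have := e.injective (hx _ h)
    simp at this

/-- Inclusion-exclusion: no independent set contains both `a` and `b`. -/
theorem indepSum_erase_add_erase {V : Type*} (G : SimpleGraph V) (x : ℝ) {S : Finset V} {a b : V}
    (ha : a ∈ S) (hab : G.Adj a b) :
    G.indepSum x (S.erase a) + G.indepSum x (S.erase b) =
      G.indepSum x S + G.indepSum x ((S.erase a).erase b) := by
  rw [indepSum_eq_erase G x ha,
    indepSum_eq_erase G x (Finset.mem_erase.2 ⟨hab.ne, ha⟩ : a ∈ S.erase b),
    Finset.erase_right_comm (a := b),
    show ((S.erase a).erase b).filter (fun u => ¬ G.Adj a u) =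
      (S.erase a).filter fun u => ¬ G.Adj a u from ?_]
  · ring
  · ext u
    simp only [Finset.mem_filter, Finset.mem_erase]
    constructor
    · tauto
    · rintro ⟨h, h'⟩
      exact ⟨⟨fun hu => h' (hu ▸ hab), h⟩, h'⟩

theorem indepPoly_eq_of_eval {W : Type*} [Fintype V] [Fintype W] {H : SimpleGraph W}
    (h : ∀ x : ℝ, G.indepSum x Finset.univ = H.indepSum x Finset.univ) :
    G.indepPoly = H.indepPoly :=
  Polynomial.funext fun x => by rw [eval_indepPoly, eval_indepPoly, h]

/-- Contracting the matching and attaching pendant vertices again does not change the independence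
polynomial, also if one matching edge lies in the interior of a `4`-cycle. -/
theorem IsTightMatching.indepPoly_eq [Fintype V] [Fintype ι] {e : ι ⊕ ι ≃ V}
    (he : G.IsTightMatching e) (huni : G.IsUnicyclic) (hconn : G.Connected)
    (hV : 4 < Fintype.card V)
    (hleaf : ∀ i, (∀ b, G.Adj (e (.inr i)) b → b = e (.inl i)) ∨ G.IsInnerEdge e (.inl i)) :
    G.indepPoly = (G.matchQuotient e).graphStar.indepPoly := by
  have hcomap : (G.comap e).indepPoly = G.indepPoly :=
    Polynomial.funext fun x => eval_indepPoly_comap G e x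
  rw [← hcomap]
  refine indepPoly_eq_of_eval fun t => ?_
  by_cases hall : ∀ i, ∀ b, G.Adj (e (.inr i)) b → b = e (.inl i)
  · exact indepSum_congr t fun x _ y _ => graphStar_matchQuotient_adj he.adj (hall _) (hall _)
  push Not at hall
  obtain ⟨i, hi⟩ := hall
  have hinner : G.IsInnerEdge e (.inl i) := (hleaf i).resolve_left fun h => by
    obtain ⟨b, hb, hb'⟩ := hi
    exact hb' (h b hb)
  have hleaf : ∀ j, j ≠ i → ∀ b, G.Adj (e (.inr j)) b → b = e (.inl j) := fun j hj =>
    (hleaf j).resolve_right fun h => hj <| by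
      simpa using he.inner_unique huni hconn hV h hinner
  obtain ⟨⟨y, hxy, hy⟩, z, hxz, hz⟩ := hinner
  simp only [Sum.swap_inl] at hy hxz
  have hyz := he.adj_of_adj hxy hy hxz hz
  have hN := fun w => he.eq_of_adj huni (x := .inl i) (w := w) hxy hy hxz hz
  have hN' := fun w => he.eq_of_adj huni (x := .inr i) (w := w) hxz hz hxy hy
  simp only [Sum.swap_inl, Sum.swap_inr] at hN hN'
  -- A vertex off the inner edge with two neighbours is no leaf, so it is a left end. This applies
  -- to both remaining vertices of the 4-cycle.
  have hinl : ∀ {y w w' : V}, y ≠ e (.inl i) → y ≠ e (.inr i) → G.Adj y w → G.Adj y w' → w ≠ w' →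
      ∃ p, p ≠ i ∧ y = e (.inl p) := by
    intro y w w' h1 h2 hw hw' hne
    obtain ⟨p | p, rfl⟩ := e.surjective y
    · exact ⟨p, fun h => h1 (by rw [h]), rfl⟩
    · have hp : p ≠ i := fun h => h2 (by rw [h])
      exact absurd ((hleaf p hp _ hw).trans (hleaf p hp _ hw').symm) hne
  obtain ⟨p, hp, rfl⟩ := hinl hxy.ne.symm hy hxy.symm hyz hz.symm
  obtain ⟨q, hq, rfl⟩ := hinl hz hxz.ne.symm hxz.symm hyz.symm hy.symm
  have hQ : ∀ j, (G.matchQuotient e).Adj i j ↔ j = p ∨ j = q := by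
    intro j
    constructor
    · rintro ⟨hij, a, b, hab, ha, rfl⟩
      rcases (matchIndex_eq_iff e).1 ha with rfl | rfl
      · rcases hN b hab with rfl | rfl
        · simp at hij
        · simp
      · rcases hN' b hab with rfl | rfl
        · simp at hij
        · simp
    · rintro (rfl | rfl)
      · exact ⟨hp.symm, _, _, hxy, by simp, by simp⟩
      · exact ⟨hq.symm, _, _, hxz, by simp, by simp⟩
  set S : Finset (ι ⊕ ι) := Finset.univ.filter fun x => Sum.elim id id x ≠ i with hS
  have hagree : ∀ T ⊆ S, (G.comap e).indepSum t T = (G.matchQuotient e).graphStar.indepSum t T := by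
    intro T hT
    exact indepSum_congr t fun x hx y hy => graphStar_matchQuotient_adj he.adj
      (hleaf _ (Finset.mem_filter.1 (hT hx)).2) (hleaf _ (Finset.mem_filter.1 (hT hy)).2)
  have hid : (G.comap e).indepSum t (S.erase (.inl p)) + (G.comap e).indepSum t (S.erase (.inl q)) =
      (G.comap e).indepSum t S + (G.comap e).indepSum t ((S.erase (.inl p)).erase (.inl q)) := by
    convert indepSum_erase_add_erase (G.comap e) t (S := S) (a := .inl p) (b := .inl q)
      (by simp [hS, hp]) hyz
  have hmem : ∀ x, x ∈ S ↔ x ≠ .inl i ∧ x ≠ .inr i := by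
    rintro (j | j) <;> simp [hS]
  have hA1 : ∀ x, (G.comap e).Adj (.inl i) x ↔ x = .inr i ∨ x = .inl p := fun x =>
    ⟨fun h => (hN _ h).imp (fun h => e.injective h) fun h => e.injective h, by
      rintro (rfl | rfl)
      · exact he.adj (.inl i)
      · exact hxy⟩
  have hA2 : ∀ x, (G.comap e).Adj (.inr i) x ↔ x = .inl i ∨ x = .inl q := fun x =>
    ⟨fun h => (hN' _ h).imp (fun h => e.injective h) fun h => e.injective h, by
      rintro (rfl | rfl)
      · exact he.adj (.inr i)
      · exact hxz⟩
  have hB1 : ∀ x, (G.matchQuotient e).graphStar.Adj (.inl i) x ↔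
      x = .inr i ∨ x = .inl p ∨ x = .inl q := by
    rintro (j | j)
    · change (G.matchQuotient e).Adj i j ↔ _
      simp [hQ]
    · change i = j ↔ _
      simp [eq_comm]
  have hB2 : ∀ x, (G.matchQuotient e).graphStar.Adj (.inr i) x ↔ x = .inl i := by
    rintro (j | j)
    · change i = j ↔ _
      simp [eq_comm]
    · change False ↔ _
      simp
  rw [indepSum_eq_add (G.comap e) t (v := .inr i) (S := insert (.inl i) S) (U := S.erase (.inl q))
      (by simp [hmem]) (fun x => by simp [hmem]; tauto)
      (fun x => by
        rw [hA2, Finset.mem_erase, Finset.mem_insert]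
        have := (hmem x).1
        tauto),
    indepSum_eq_add (G.comap e) t (v := .inl i) (S := S) (U := S.erase (.inl p))
      (by simp [hmem]) (fun x => by simp)
      (fun x => by
        rw [hA1, Finset.mem_erase]
        have := (hmem x).1
        tauto),
    indepSum_eq_add (G.matchQuotient e).graphStar t (v := .inr i) (S := insert (.inl i) S) (U := S)
      (by simp [hmem]) (fun x => by simp [hmem]; tauto)
      (fun x => by
        rw [hB2, Finset.mem_insert]
        have := (hmem x).1
        tauto),
    indepSum_eq_add (G.matchQuotient e).graphStar t (v := .inl i) (S := S)
      (U := (S.erase (.inl p)).erase (.inl q))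
      (by simp [hmem]) (fun x => by simp)
      (fun x => by
        rw [hB1, Finset.mem_erase, Finset.mem_erase]
        have := (hmem x).1
        tauto),
    ← hagree S (Finset.Subset.refl S),
    ← hagree _ ((Finset.erase_subset _ _).trans (Finset.erase_subset _ _))]
  -- The expansions are `I(S) + t I(S - p) + t I(S - q)` for `G` and `I(S) + t I(S - p - q) + t
  -- I(S)` for the corona.
  linear_combination t * hid

end Corona

end SimpleGraph

theorem mainTheorem2 {V : Type*} [Fintype V] (G : SimpleGraph V) (n : ℕ) (hn : 3 ≤ n)
    (hcard : Fintype.card V = 2 * n) (hconn : G.Connected) (huni : G.IsUnicyclic)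
    (hwc : G.IsWellCovered) :
    ((SimpleGraph.cycleGraph n).graphStar.IndepLE G ∧
      G.IndepLE (SimpleGraph.triangleStar n).graphStar) ∧
    ((SimpleGraph.cycleGraph n).graphStar.xi ≤ G.xi ∧
      G.xi ≤ (SimpleGraph.triangleStar n).graphStar.xi) := by
  classical
  have := hconn.nonempty
  obtain ⟨u, v, huv, hT⟩ := huni.exists_isTree hconn
  obtain ⟨k, hk, hk'⟩ := hwc.exists_card
  obtain ⟨rfl, X, e₀, he₀⟩ := SimpleGraph.exists_perfect_matching hk hk' huv hT (by omega) hcard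
  have hX : Fintype.card X = k := by
    have := Fintype.card_congr e₀
    rw [Fintype.card_sum] at this
    omega
  obtain ⟨e, hee, hleaf⟩ := SimpleGraph.exists_leaf_right (G := G) (e := e₀)
  have he₀' : ∀ x, G.Adj (e₀ x) (e₀ x.swap) := by
    rintro (i | i)
    · exact he₀ i
    · exact (he₀ i).symm
  have he : G.IsTightMatching e := SimpleGraph.isTightMatching_of_card (fun x => by
    rcases hee x with h | h
    · rw [h.1, h.2]; exact he₀' x
    · rw [h.1, h.2]; exact (he₀' x).symm) (by rwa [hX])
  have hV : 4 < Fintype.card V := by omega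
  have hE := SimpleGraph.card_edgeFinset_of_isTree huv hT
  obtain ⟨u', v', huv', hT'⟩ := (SimpleGraph.matchQuotient_connected e hconn).exists_isTree_of_card
    (he.card_edgeFinset_matchQuotient huni hconn hV hE)
  exact SimpleGraph.graphStar_bounds huv' hT' hn hX (he.indepPoly_eq huni hconn hV hleaf)
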